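/- Conventions. Let $X$ be a Hausdorff, second countable space. A uniformizing system at $p\in X$ is a triple $(V_p,G_p,\pi_p)$ in which $V_p$ is an open ball around the origin $o$ of some $\mathbf R^n$, $G_p$ is a finite group acting smoothly, not necessarily effectively, on $V_p$, and $\pi_p:V_p\to X$ is a continuous map inducing a homeomorphism of $V_p/G_p$ onto an open set $U_p\ni p$, with $\pi_p^{-1}(p)=\{o\}$. For $q\in U_p$, an injection of the system at $q$ into the system at $p$ is a pair $(\psi,\tau)$ of a monomorphism $\tau:G_q\to G_p$, mapping the kernel of the action of $G_q$ onto that of $G_p$, and a $\tau$-equivariant smooth open embedding $\psi$ of a connected $G_q$-invariant open neighbourhood of $o\in V_q$ into $V_p$ with $\pi_p\circ\psi=\pi_q$. An orbifold structure on $X$ consists of a uniformizing system at each $p\in X$, and, for each $p\in X$ and $q\in U_p$, a nonempty set of patching injections of the system at $q$ into the system at $p$, whose germs at $o$ form one class under composition with the automorphisms $(x\mapsto gx,\ a\mapsto gag^{-1})$, $g\in G_p$, of $(V_p,G_p,\pi_p)$, such that germs of patching injections compose to patching injections. (The dimension $n$ is locally constant; it may vary between connected components.) $X$ is reduced if every $G_p$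 acts effectively. An almost complex structure on $X$ is a smooth section $J$ of $\mathrm{End}(TX)$ with $J^2=-1$, that is, a family of smooth $G_p$-equivariant endomorphism fields on the $V_p$ with square $-1$, intertwined by the patching injections. A $C^\infty$ map of orbifolds is a continuous map with a family of local smooth liftings, at each point $p$, to the uniformizing systems, such that the liftings at $p$ and at nearby points $q$ induce the same germ of liftings at $q$. Closed means compact (without boundary). Statement. If uniformizing systems are given at all points of $X$ such that for all $p$ and all $q\in U_p$ some injection of the system at $q$ into the system at $p$ exists, and if all $G_p$ act effectively, then there is exactly one choice of patching injections making $X$ an orbifold. Now let $X$ be any orbifold and $k\ge 0$. Let $\widetilde X_k$ be the set of pairs $(p,(\mathbf g))$ with $p\in X$ and $(\mathbf g)$ the simultaneous conjugacy class of $\mathbf g=(g_1,\dots,g_k)\in G_p^k$; write $\widetilde X=\widetilde X_1$. Put $V_p^{\mathbf g}=\bigcap_i V_p^{g_i}$ (with $V_p^{g}$ the fixed-point set of $g$; $V_p^{\mathbf g}=V_p$ if $k=0$) and $C(\mathbf g)=\bigcap_i C(g_i)$ (with $C(g)$ the centralizer of $g$ in $G_p$; $C(\mathbf g)=G_p$ if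 $k=0$). Let $\pi_{p,\mathbf g}:V_p^{\mathbf g}\to\widetilde X_k$ send $y$ to $(q,(\mathbf h))$, where $q=\pi_p(y)$ and $\tau(\mathbf h)=\mathbf g$ for a patching injection $(\psi,\tau)$ of the system at $q$ into the system at $p$ with $\psi(o)=y$. Give $\widetilde X_k$ the topology in which a set is open if and only if its preimages under all $\pi_{p,\mathbf g}$ are open. Then: 1. Each $\pi_{p,\mathbf g}$ is well defined, sends $o$ to $(p,(\mathbf g))$, and induces a homeomorphism of $V_p^{\mathbf g}/C(\mathbf g)$ onto an open subset of $\widetilde X_k$. 2. $\widetilde X_k$ is an orbifold (in particular Hausdorff and second countable), with the orbifold structure given by $\{\pi_{p,\mathbf g}:(V_p^{\mathbf g},C(\mathbf g))\to V_p^{\mathbf g}/C(\mathbf g)\}$: there is an orbifold structure whose uniformizing system at $(p,(\mathbf g))$ is the restriction of $(V_p^{\mathbf g},C(\mathbf g),\pi_{p,\mathbf g})$ to a $C(\mathbf g)$-invariant open neighbourhood of $o$ in $V_p^{\mathbf g}$ (diffeomorphic to a ball), and whose patching injections are the restrictions of those patching injections $(\psi,\tau)$ of $X$ with $\tau(\mathbf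 h)=\mathbf g$. For every such structure, $(V_p^{\mathbf g},C(\mathbf g),\pi_{p,\mathbf g})$ defines its germ at every $y\in V_p^{\mathbf g}$, and 3, 4 and 5 hold. 3. The projection $(p,(\mathbf g))\mapsto p$ is a $C^\infty$ map $\widetilde X_k\to X$ with the inclusions $V_p^{\mathbf g}\subseteq V_p$ as local liftings, and for $1\le i\le k$ the map $e_i:\widetilde X_k\to\widetilde X$, $(p,(\mathbf g))\mapsto(p,(g_i))$, is a $C^\infty$ map with the inclusions $V_p^{\mathbf g}\subseteq V_p^{g_i}$ as local liftings. 4. Every almost complex structure $J$ on $X$ restricts to an almost complex structure on $\widetilde X_k$, namely the one for which the inclusions $V_p^{\mathbf g}\subseteq V_p$ are pseudo-holomorphic; in that case the fixed-point set of each group element in each uniformizing system of $\widetilde X_k$ is the whole system or has codimension at least two. 5. If $X$ is compact, then $\widetilde X_k$ is compact and has finitely many connected components; each is open and closed and, with the restricted orbifold structure, is a closed connected orbifold of some fixed dimension. So $\widetilde X_k$ is a finite disjoint union of closed orbifolds. -/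

import Mathlib

open Set Filter Topology
open scoped ContDiff

universe u v w

/-- The model space `ℝⁿ` with its Euclidean norm. -/
abbrev OrbModel (n : ℕ) : Type := EuclideanSpace ℝ (Fin n)

/-! ### Uniformizing systems -/

/-- A uniformizing system `(V, G, π)` of an open neighbourhood of `p`: `V` is an open ball around
the origin of `ℝⁿ`, `G` is a finite group acting smoothly (not necessarily effectively) on `V`, and
`π : V → X` is continuous, open, and has exactly the `G`-orbits as fibres, so that it induces a
homeomorphism of `V / G` onto an open subset of `X`; the origin is the only point over `p`. -/
structure OrbChart {X : Type u} [TopologicalSpace X] (p : X) where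
  dim : ℕ
  radius : ℝ
  radius_pos : 0 < radius
  Grp : Type v
  [group : Group Grp]
  [finite : Finite Grp]
  act : Grp → OrbModel dim → OrbModel dim
  act_mem : ∀ g, ∀ x ∈ Metric.ball (0 : OrbModel dim) radius,
    act g x ∈ Metric.ball (0 : OrbModel dim) radius
  act_one : ∀ x ∈ Metric.ball (0 : OrbModel dim) radius, act 1 x = x
  act_mul : ∀ g h, ∀ x ∈ Metric.ball (0 : OrbModel dim) radius, act (g * h) x = act g (act h x)
  act_smooth : ∀ g, ContDiffOn ℝ ∞ (act g) (Metric.ball (0 : OrbModel dim) radius)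
  proj : OrbModel dim → X
  proj_continuousOn : ContinuousOn proj (Metric.ball (0 : OrbModel dim) radius)
  proj_open : ∀ W ⊆ Metric.ball (0 : OrbModel dim) radius, IsOpen W → IsOpen (proj '' W)
  proj_eq_proj_iff : ∀ x ∈ Metric.ball (0 : OrbModel dim) radius,
    ∀ y ∈ Metric.ball (0 : OrbModel dim) radius, proj x = proj y ↔ ∃ g, act g x = y
  proj_eq_iff : ∀ x ∈ Metric.ball (0 : OrbModel dim) radius, proj x = p ↔ x = 0

attribute [instance] OrbChart.group OrbChart.finite

namespace OrbChart

variable {X : Type u} [TopologicalSpace X] {p : X}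

/-- The ball `V`. -/
def V (A : OrbChart.{u, v} p) : Set (OrbModel A.dim) := Metric.ball 0 A.radius

/-- The uniformized open set `π(V)`. -/
def image (A : OrbChart.{u, v} p) : Set X := A.proj '' A.V

/-- `g` lies in the kernel of the action. -/
def ActsTrivially (A : OrbChart.{u, v} p) (g : A.Grp) : Prop := ∀ x ∈ A.V, A.act g x = x

/-- `V^𝐠 = V^{g₁} ∩ ⋯ ∩ V^{g_k}`. -/
def fixedSet (A : OrbChart.{u, v} p) {k : ℕ} (g : Fin k → A.Grp) : Set (OrbModel A.dim) :=
  {x | x ∈ A.V ∧ ∀ i, A.act (g i) x = x}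

/-- The fixed-point set of each group element is all of `V` or has codimension at least two. (Its
tangent space at a fixed point `x` is the space of vectors fixed by the derivative at `x`.) -/
def CodimTwo (A : OrbChart.{u, v} p) : Prop :=
  ∀ g : A.Grp, A.ActsTrivially g ∨ ∀ x ∈ A.V, A.act g x = x →
    Module.finrank ℝ (LinearMap.ker
      ((fderiv ℝ (A.act g) x - ContinuousLinearMap.id ℝ (OrbModel A.dim)).toLinearMap)) + 2 ≤ A.dim

end OrbChart

/-- An injection `(ψ, τ)` into `(V_B, G_B, π_B)` of the uniformizing system that `(V_A, G_A, π_A)`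
induces on a connected neighbourhood of its centre: `ψ` is a `τ`-equivariant smooth open embedding
of a connected `G_A`-invariant open neighbourhood of the origin, over the identity of `X`, and the
monomorphism `τ` maps the kernel of the action of `G_A` onto that of `G_B`. -/
structure OrbInjection {X : Type u} [TopologicalSpace X] {q p : X}
    (A : OrbChart.{u, v} q) (B : OrbChart.{u, v} p) where
  dom : Set (OrbModel A.dim)
  dom_open : IsOpen dom
  dom_connected : IsPreconnected dom
  zero_mem_dom : (0 : OrbModel A.dim) ∈ dom
  dom_subset : dom ⊆ A.V
  dom_invariant : ∀ a, ∀ x ∈ dom, A.act a x ∈ dom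
  toFun : OrbModel A.dim → OrbModel B.dim
  mapsTo : MapsTo toFun dom B.V
  smooth : ContDiffOn ℝ ∞ toFun dom
  injOn : InjOn toFun dom
  fderiv_bijective : ∀ x ∈ dom, Function.Bijective (fderiv ℝ toFun x)
  hom : A.Grp →* B.Grp
  hom_injective : Function.Injective hom
  hom_kernel : ∀ b, B.ActsTrivially b ↔ ∃ a, A.ActsTrivially a ∧ hom a = b
  equivariant : ∀ a, ∀ x ∈ dom, toFun (A.act a x) = B.act (hom a) (toFun x)
  proj_comp : ∀ x ∈ dom, B.proj (toFun x) = A.proj x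

/-! ### Orbifolds -/

/-- A family of uniformizing systems, one centred at each point of a Hausdorff second countable
space, such that for `q ∈ π_p(V_p)` the systems at `p` and at `q` are equivalent at `q`. The
dimension is locally constant, and may differ from one connected component to another. -/
structure OrbAtlas (X : Type u) [TopologicalSpace X] where
  t2 : T2Space X
  secondCountable : SecondCountableTopology X
  chart : ∀ p : X, OrbChart.{u, v} p
  equivalent : ∀ p, ∀ q ∈ (chart p).image, Nonempty (OrbInjection (chart q) (chart p))

namespace OrbAtlas

variable {X : Type u} [TopologicalSpace X]

/-- All the groups `G_p` act effectively. -/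
def Reduced (A : OrbAtlas.{u, v} X) : Prop :=
  ∀ p, ∀ g : (A.chart p).Grp, (A.chart p).ActsTrivially g → g = 1

/-- Fixed-point sets of group elements are everything or of codimension at least two. -/
def CodimTwo (A : OrbAtlas.{u, v} X) : Prop := ∀ p, (A.chart p).CodimTwo

end OrbAtlas

/-- An orbifold: a family of uniformizing systems together with the patching injections between
them. For `q ∈ π_p(V_p)` the germs at the origin of patching injections from the system at `q` to
the system at `p` form one class under composition with the automorphisms `(g, Ad g)`, `g ∈ G_p`,
and patching injections compose. -/
structure Orbifold (X : Type u) [TopologicalSpace X] extends OrbAtlas.{u, v} X where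
  inj : ∀ q p : X, Set (OrbInjection (chart q) (chart p))
  inj_nonempty : ∀ p, ∀ q ∈ (chart p).image, (inj q p).Nonempty
  mem_inj_iff : ∀ q p, ∀ φ ∈ inj q p, ∀ ψ : OrbInjection (chart q) (chart p),
    ψ ∈ inj q p ↔ ∃ g : (chart p).Grp,
      (∀ᶠ x in 𝓝 (0 : OrbModel (chart q).dim), ψ.toFun x = (chart p).act g (φ.toFun x)) ∧
      ∀ a, ψ.hom a = g * φ.hom a * g⁻¹
  inj_comp : ∀ q p, ∀ χ ∈ inj q p, ∀ᶠ y in 𝓝 (0 : OrbModel (chart q).dim),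
    ∀ r, ∀ φ ∈ inj r q, φ.toFun 0 = y → ∀ η : OrbInjection (chart r) (chart p),
      (∀ᶠ x in 𝓝 (0 : OrbModel (chart r).dim), η.toFun x = χ.toFun (φ.toFun x)) →
      (∀ a, η.hom a = χ.hom (φ.hom a)) → η ∈ inj r p

/-- A `C^∞` map between orbifolds with underlying map `f`: local smooth liftings `f̃_p` such that
for every `q` in the domain of `f̃_p`, `f̃_p` and `f̃_q` induce the same germ of liftings at `q`. -/
structure OrbSmoothMap {X : Type u} {Y : Type w} [TopologicalSpace X] [TopologicalSpace Y]
    (O : Orbifold.{u, v} X) (O' : Orbifold.{w, v} Y) (f : X → Y) where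
  continuous : Continuous f
  dom : ∀ p : X, Set (OrbModel (O.chart p).dim)
  dom_open : ∀ p, IsOpen (dom p)
  dom_connected : ∀ p, IsPreconnected (dom p)
  zero_mem_dom : ∀ p, (0 : OrbModel (O.chart p).dim) ∈ dom p
  dom_subset : ∀ p, dom p ⊆ (O.chart p).V
  dom_invariant : ∀ p, ∀ a, ∀ x ∈ dom p, (O.chart p).act a x ∈ dom p
  lift : ∀ p : X, OrbModel (O.chart p).dim → OrbModel (O'.chart (f p)).dim
  lift_mem : ∀ p, MapsTo (lift p) (dom p) (O'.chart (f p)).V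
  lift_smooth : ∀ p, ContDiffOn ℝ ∞ (lift p) (dom p)
  lift_proj : ∀ p, ∀ x ∈ dom p, (O'.chart (f p)).proj (lift p x) = f ((O.chart p).proj x)
  lift_equivariant : ∀ p, ∀ a : (O.chart p).Grp, ∃ b : (O'.chart (f p)).Grp,
    ∀ x ∈ dom p, (O'.chart (f p)).act b (lift p x) = lift p ((O.chart p).act a x)
  lift_compatible : ∀ p q, ∀ φ ∈ O.inj q p, φ.toFun 0 ∈ dom p → ∃ ψ ∈ O'.inj (f q) (f p),
    ∀ᶠ x in 𝓝 (0 : OrbModel (O.chart q).dim), lift p (φ.toFun x) = ψ.toFun (lift q x)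

/-- An almost complex structure: a smooth section `J` of `End(TX)` with `J² = -1`, that is, a family
of equivariant smooth endomorphism fields on the balls `V_p` which the injections intertwine. -/
structure OrbAlmostComplex {X : Type u} [TopologicalSpace X] (O : Orbifold.{u, v} X) where
  J : ∀ p : X, OrbModel (O.chart p).dim →
    (OrbModel (O.chart p).dim →L[ℝ] OrbModel (O.chart p).dim)
  smooth : ∀ p, ContDiffOn ℝ ∞ (J p) (O.chart p).V
  sq : ∀ p, ∀ x ∈ (O.chart p).V, (J p x).comp (J p x) = -ContinuousLinearMap.id ℝ _
  equivariant : ∀ p, ∀ g : (O.chart p).Grp, ∀ x ∈ (O.chart p).V,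
    (fderiv ℝ ((O.chart p).act g) x).comp (J p x) =
      (J p ((O.chart p).act g x)).comp (fderiv ℝ ((O.chart p).act g) x)
  compatible : ∀ p q, ∀ φ ∈ O.inj q p, ∀ᶠ x in 𝓝 (0 : OrbModel (O.chart q).dim),
    (fderiv ℝ φ.toFun x).comp (J q x) = (J p (φ.toFun x)).comp (fderiv ℝ φ.toFun x)

/-! ### Restriction to a union of uniformized sets -/

open Classical in
/-- A uniformizing system whose image lies in the open set `U`, as a uniformizing system in `U`. -/
noncomputable def OrbChart.restrict {X : Type u} [TopologicalSpace X] {U : Set X} (p : U)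
    (A : OrbChart.{u, v} (p : X)) (h : A.image ⊆ U) : OrbChart.{u, v} p where
  dim := A.dim
  radius := A.radius
  radius_pos := A.radius_pos
  Grp := A.Grp
  act := A.act
  act_mem := A.act_mem
  act_one := A.act_one
  act_mul := A.act_mul
  act_smooth := A.act_smooth
  proj := fun x => if hx : A.proj x ∈ U then ⟨A.proj x, hx⟩ else p
  proj_continuousOn := by
    rw [Topology.IsInducing.subtypeVal.continuousOn_iff]
    refine A.proj_continuousOn.congr fun x hx => ?_
    have : A.proj x ∈ U := h ⟨x, hx, rfl⟩
    simp [this]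
  proj_open := by
    intro W hW hWo
    refine ⟨A.proj '' W, A.proj_open W hW hWo, ?_⟩
    ext y
    constructor
    · rintro ⟨x, hx, hxy⟩
      refine ⟨x, hx, ?_⟩
      have : A.proj x ∈ U := h ⟨x, hW hx, rfl⟩
      simp only [this, dite_true]
      exact Subtype.ext hxy
    · rintro ⟨x, hx, rfl⟩
      have : A.proj x ∈ U := h ⟨x, hW hx, rfl⟩
      simp only [this, dite_true]
      exact ⟨x, hx, rfl⟩
  proj_eq_proj_iff := by
    intro x hx y hy
    have h1 : A.proj x ∈ U := h ⟨x, hx, rfl⟩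
    have h2 : A.proj y ∈ U := h ⟨y, hy, rfl⟩
    simp only [h1, h2, dite_true, Subtype.mk.injEq]
    exact A.proj_eq_proj_iff x hx y hy
  proj_eq_iff := by
    intro x hx
    have h1 : A.proj x ∈ U := h ⟨x, hx, rfl⟩
    simp only [h1, dite_true]
    rw [← A.proj_eq_iff x hx, Subtype.ext_iff]

theorem OrbChart.restrict_proj {X : Type u} [TopologicalSpace X] {U : Set X} (p : U)
    (A : OrbChart.{u, v} (p : X)) (h : A.image ⊆ U) (x : OrbModel A.dim) (hx : x ∈ A.V) :
    (((A.restrict p h).proj x : U) : X) = A.proj x := by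
  have h1 : A.proj x ∈ U := h ⟨x, hx, rfl⟩
  simp [OrbChart.restrict, h1]

/-- Injections between restricted systems are the injections between the original ones. -/
def OrbInjection.restrictEquiv {X : Type u} [TopologicalSpace X] {U : Set X} (q p : U)
    (A : OrbChart.{u, v} (q : X)) (B : OrbChart.{u, v} (p : X)) (hA : A.image ⊆ U)
    (hB : B.image ⊆ U) :
    OrbInjection (A.restrict q hA) (B.restrict p hB) ≃ OrbInjection A B where
  toFun φ :=
    { dom := φ.dom
      dom_open := φ.dom_open
      dom_connected := φ.dom_connected
      zero_mem_dom := φ.zero_mem_dom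
      dom_subset := φ.dom_subset
      dom_invariant := φ.dom_invariant
      toFun := φ.toFun
      mapsTo := φ.mapsTo
      smooth := φ.smooth
      injOn := φ.injOn
      fderiv_bijective := φ.fderiv_bijective
      hom := φ.hom
      hom_injective := φ.hom_injective
      hom_kernel := φ.hom_kernel
      equivariant := φ.equivariant
      proj_comp := fun x hx => by
        rw [← OrbChart.restrict_proj p B hB _ (φ.mapsTo hx),
          ← OrbChart.restrict_proj q A hA _ (φ.dom_subset hx)]
        exact congrArg Subtype.val (φ.proj_comp x hx) }
  invFun φ :=
    { dom := φ.dom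
      dom_open := φ.dom_open
      dom_connected := φ.dom_connected
      zero_mem_dom := φ.zero_mem_dom
      dom_subset := φ.dom_subset
      dom_invariant := φ.dom_invariant
      toFun := φ.toFun
      mapsTo := φ.mapsTo
      smooth := φ.smooth
      injOn := φ.injOn
      fderiv_bijective := φ.fderiv_bijective
      hom := φ.hom
      hom_injective := φ.hom_injective
      hom_kernel := φ.hom_kernel
      equivariant := φ.equivariant
      proj_comp := fun x hx => by
        apply Subtype.ext
        refine (OrbChart.restrict_proj p B hB _ (φ.mapsTo hx)).trans ?_
        refine Eq.trans ?_ (OrbChart.restrict_proj q A hA _ (φ.dom_subset hx)).symm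
        exact φ.proj_comp x hx }
  left_inv _ := rfl
  right_inv _ := rfl

namespace Orbifold

variable {X : Type u} [TopologicalSpace X]

/-- The orbifold structure on an open set `U` that contains the uniformized sets `π_p(V_p)` of all
its points `p`, with the same uniformizing systems and the same patching injections. -/
noncomputable def restrict (O : Orbifold.{u, v} X) (U : Set X)
    (hU : ∀ p ∈ U, (O.chart p).image ⊆ U) : Orbifold.{u, v} U where
  t2 := by
    have := O.t2
    infer_instance
  secondCountable := by
    have := O.secondCountable
    infer_instance
  chart p := (O.chart (p : X)).restrict p (hU p p.2)
  equivalent := by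
    rintro p q ⟨x, hx, hxq⟩
    have hq : (q : X) ∈ (O.chart (p : X)).image :=
      ⟨x, hx, by rw [← hxq, OrbChart.restrict_proj p _ (hU p p.2) x hx]⟩
    exact ⟨(OrbInjection.restrictEquiv q p _ _ (hU q q.2) (hU p p.2)).symm
      (O.equivalent p q hq).some⟩
  inj q p := {φ | OrbInjection.restrictEquiv q p _ _ (hU q q.2) (hU p p.2) φ ∈ O.inj q p}
  inj_nonempty := by
    rintro p q ⟨x, hx, hxq⟩
    have hq : (q : X) ∈ (O.chart (p : X)).image :=
      ⟨x, hx, by rw [← hxq, OrbChart.restrict_proj p _ (hU p p.2) x hx]⟩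
    obtain ⟨φ, hφ⟩ := O.inj_nonempty p q hq
    exact ⟨(OrbInjection.restrictEquiv q p _ _ (hU q q.2) (hU p p.2)).symm φ, hφ⟩
  mem_inj_iff := fun q p φ hφ ψ => O.mem_inj_iff q p _ hφ
    (OrbInjection.restrictEquiv q p _ _ (hU q q.2) (hU p p.2) ψ)
  inj_comp := fun q p χ hχ => (O.inj_comp q p _ hχ).mono fun _ hy r φ hφ h0 η h1 h2 =>
    hy r _ hφ h0 (OrbInjection.restrictEquiv r p _ _ (hU r r.2) (hU p p.2) η) h1 h2

/-- A closed (compact, without boundary) connected orbifold of dimension `n`. -/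
def IsClosedConnected (O : Orbifold.{u, v} X) (n : ℕ) : Prop :=
  CompactSpace X ∧ ConnectedSpace X ∧ ∀ p, (O.chart p).dim = n

/-! ### Multi-sectors -/

end Orbifold

/-- Simultaneous conjugacy of `k`-tuples of group elements. -/
def conjTupleSetoid (G : Type v) [Group G] (k : ℕ) : Setoid (Fin k → G) where
  r g h := ∃ a : G, ∀ i, h i = a * g i * a⁻¹
  iseqv :=
    { refl := fun g => ⟨1, fun i => by simp⟩
      symm := by
        rintro g h ⟨a, ha⟩
        exact ⟨a⁻¹, fun i => by rw [ha i]; group⟩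
      trans := by
        rintro g h l ⟨a, ha⟩ ⟨b, hb⟩
        exact ⟨b * a, fun i => by rw [hb i, ha i]; group⟩ }

/-- Conjugacy classes `(𝐠)` of `k`-tuples. -/
def ConjTuple (G : Type v) [Group G] (k : ℕ) : Type v := Quotient (conjTupleSetoid G k)

/-- The conjugacy class of a tuple. -/
def ConjTuple.mk {G : Type v} [Group G] {k : ℕ} (g : Fin k → G) : ConjTuple G k :=
  Quotient.mk (conjTupleSetoid G k) g

/-- The class `(g_i)` of the `i`-th entry of a class `(𝐠)`. -/
def ConjTuple.entry {G : Type v} [Group G] {k : ℕ} (i : Fin k) (c : ConjTuple G k) :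
    ConjTuple G 1 :=
  Quotient.map' (s₁ := conjTupleSetoid G k) (s₂ := conjTupleSetoid G 1)
    (fun g _ => g i) (fun _ _ ⟨a, ha⟩ => ⟨a, fun _ => ha i⟩) c

namespace Orbifold

variable {X : Type u} [TopologicalSpace X]

/-- The `k`-multi-sector: pairs of a point `p` and a conjugacy class of `k`-tuples in `G_p`. -/
@[ext] structure MultiSector (O : Orbifold.{u, v} X) (k : ℕ) where
  pt : X
  cls : ConjTuple (O.chart pt).Grp k

/-- The evaluation map `e_i : (p, (𝐠)) ↦ (p, (g_i))` to the sector space `k = 1`. -/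
def evalMap (O : Orbifold.{u, v} X) {k : ℕ} (i : Fin k) (z : O.MultiSector k) : O.MultiSector 1 :=
  ⟨z.pt, z.cls.entry i⟩

/-- `z = (q, (𝐡))` is the point of the multi-sector represented by `y ∈ V_p^𝐠`: some patching
injection `(ψ, τ)` of the system at `q` into the system at `p` has `ψ(0) = y` and `τ(𝐡) = 𝐠`. -/
def IsSectorPoint (O : Orbifold.{u, v} X) {k : ℕ} (p : X) (g : Fin k → (O.chart p).Grp)
    (y : OrbModel (O.chart p).dim) (z : O.MultiSector k) : Prop :=
  ∃ h : Fin k → (O.chart z.pt).Grp, z.cls = ConjTuple.mk h ∧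
    ∃ φ ∈ O.inj z.pt p, φ.toFun 0 = y ∧ ∀ i, φ.hom (h i) = g i

open Classical in
/-- The map `π_{p,𝐠} : V_p^𝐠 → X̃_k` sending `y` to the point it represents. -/
noncomputable def sectorMap (O : Orbifold.{u, v} X) {k : ℕ} (p : X) (g : Fin k → (O.chart p).Grp)
    (y : OrbModel (O.chart p).dim) : O.MultiSector k :=
  if h : ∃ z, O.IsSectorPoint p g y z then h.choose
  else ⟨(O.chart p).proj y, ConjTuple.mk fun _ => 1⟩

/-- The topology of the multi-sector: a set is open when its preimages in all `V_p^𝐠` are. -/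
noncomputable instance multiSectorTopology (O : Orbifold.{u, v} X) (k : ℕ) :
    TopologicalSpace (O.MultiSector k) :=
  ⨆ (p : X) (g : Fin k → (O.chart p).Grp), TopologicalSpace.coinduced
    (fun y : (O.chart p).fixedSet g => O.sectorMap p g y) inferInstance

/-- `C(𝐠) = C(g₁) ∩ ⋯ ∩ C(g_k)`. -/
def tupleCentralizer (O : Orbifold.{u, v} X) {k : ℕ} {p : X} (g : Fin k → (O.chart p).Grp) :
    Subgroup (O.chart p).Grp :=
  ⨅ i, Subgroup.centralizer {g i}

/-- `π_{p,𝐠}` is well defined on `V_p^𝐠`, maps the origin to `(p, (𝐠))`, is continuous and open,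
and its fibres are the `C(𝐠)`-orbits: it induces a homeomorphism of `V_p^𝐠 / C(𝐠)` onto an open
neighbourhood of `(p, (𝐠))` in the multi-sector. -/
def SectorMapUniformizes (O : Orbifold.{u, v} X) {k : ℕ} (p : X)
    (g : Fin k → (O.chart p).Grp) : Prop :=
  (∀ y ∈ (O.chart p).fixedSet g, ∀ z, O.IsSectorPoint p g y z ↔ z = O.sectorMap p g y) ∧
  O.sectorMap p g 0 = ⟨p, ConjTuple.mk g⟩ ∧
  (Continuous fun y : (O.chart p).fixedSet g => O.sectorMap p g y) ∧
  (IsOpenMap fun y : (O.chart p).fixedSet g => O.sectorMap p g y) ∧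
  (∀ c ∈ O.tupleCentralizer g, ∀ y ∈ (O.chart p).fixedSet g,
    (O.chart p).act c y ∈ (O.chart p).fixedSet g) ∧
  ∀ y ∈ (O.chart p).fixedSet g, ∀ y' ∈ (O.chart p).fixedSet g,
    O.sectorMap p g y = O.sectorMap p g y' ↔
      ∃ c ∈ O.tupleCentralizer g, (O.chart p).act c y = y'

/-- An orbifold structure on the `k`-multi-sector given by the systems `(V_p^𝐠, C(𝐠), π_{p,𝐠})`.
The system at `z = (p, (𝐠))` is a ball, with a smooth embedding `emb z` onto an open neighbourhood
of the origin in `V_p^𝐠`, equivariant along an isomorphism `hom z` of its group onto `C(𝐠)`, under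
which its projection is `π_{p,𝐠}`; the patching injections are the restrictions to the `V_p^𝐠` of
those patching injections of `X` that match the tuples. -/
structure SectorStructure (O : Orbifold.{u, v} X) (k : ℕ) extends
    Orbifold.{max u v, v} (O.MultiSector k) where
  rep : ∀ z : O.MultiSector k, Fin k → (O.chart z.pt).Grp
  mk_rep : ∀ z, ConjTuple.mk (rep z) = z.cls
  hom : ∀ z, (chart z).Grp →* (O.chart z.pt).Grp
  hom_injective : ∀ z, Function.Injective (hom z)
  hom_range : ∀ z, (hom z).range = O.tupleCentralizer (rep z)
  emb : ∀ z, OrbModel (chart z).dim → OrbModel (O.chart z.pt).dim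
  emb_zero : ∀ z, emb z 0 = 0
  emb_smooth : ∀ z, ContDiffOn ℝ ∞ (emb z) (chart z).V
  emb_injOn : ∀ z, InjOn (emb z) (chart z).V
  emb_immersion : ∀ z, ∀ x ∈ (chart z).V, Function.Injective (fderiv ℝ (emb z) x)
  emb_open : ∀ z, ∀ W ⊆ (chart z).V, IsOpen W →
    ∃ W', IsOpen W' ∧ emb z '' W = W' ∩ (O.chart z.pt).fixedSet (rep z)
  emb_equivariant : ∀ z, ∀ a, ∀ x ∈ (chart z).V,
    emb z ((chart z).act a x) = (O.chart z.pt).act (hom z a) (emb z x)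
  proj_eq : ∀ z, ∀ x ∈ (chart z).V, (chart z).proj x = O.sectorMap z.pt (rep z) (emb z x)
  mem_inj_iff_restrict : ∀ z' z, ∀ φ : OrbInjection (chart z') (chart z),
    φ ∈ inj z' z ↔ ∃ Φ ∈ O.inj z'.pt z.pt,
      (∀ᶠ x in 𝓝 (0 : OrbModel (chart z').dim),
        Φ.toFun (emb z' x) = emb z (φ.toFun x)) ∧
      (∀ a, Φ.hom (hom z' a) = hom z (φ.hom a)) ∧
      ∀ i, Φ.hom (rep z' i) = rep z i

end Orbifold

/-! Two facts about a finite group acting smoothly on a ball carry the proof. An element that fixes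
a point to first order acts trivially (`OrbChart.actsTrivially_of_fderiv_eq_id`), and near any point
the stabilizer acts linearly in suitable coordinates (`OrbChart.exists_linearization`). Both come
from averaging. The second makes fixed-point sets submanifolds whose tangent vectors are the fixed
vectors.

Rigidity follows from the first fact and a Baire argument. Two injections between the same systems
differ near the origin by one group element (`OrbInjection.exists_eventually_eq_act`), and the image
of `τ` is the full stabilizer of `ψ(0)` (`OrbInjection.exists_hom_eq`). For effective actions the
group element also controls `τ`, so every injection must be a patching injection, which is the
uniqueness statement. For non-effective actions `ψ` does not determine `τ`, and the prescribed class
of patching injections takes the place of rigidity.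

A tuple fixing `y` lifts through `τ` to the group at the point below, and changing the patching
injection changes the lift by conjugation. Hence the sector map is well defined, and two pairs `(y,
𝐠)`, `(y', 𝐠')` represent the same point exactly when some element of `G_p` moves one to the other
(`IsSectorPoint.eq_iff`). Patching injections that match the tuples are local homeomorphisms between
fixed-point sets, so the sector maps are open. Hausdorffness, second countability and compactness
then come from `X` and the finiteness of the groups.

A uniformizing system at `(p, (𝐠))` is a small ball in the fixed subspace of the linearized action,
round for an invariant norm and therefore preserved by `C(𝐠)`. Patching injections of `X` that match
the tuples restrict to these systems (`SectorChart.exists_restricts`), and the orbifold axioms are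
inherited because the embeddings are injective. An almost complex structure commutes with the
tangent action at fixed points, so it preserves fixed vectors and restricts. Fixed subspaces then
have even dimension, and hence proper ones have codimension at least two. -/

section Calculus

/-! ### Inverse function theorem and Baire category -/

variable {E F : Type*} [NormedAddCommGroup E] [NormedSpace ℝ E] [CompleteSpace E]
  [NormedAddCommGroup F] [NormedSpace ℝ F] [CompleteSpace F]

/-- The inverse function theorem on an open set, with a smooth inverse on the whole target. -/
theorem exists_openPartialHomeomorph_of_bijective_fderiv {f : E → F} {S : Set E} {a : E}
    (hS : IsOpen S) (ha : a ∈ S) (hf : ContDiffOn ℝ ∞ f S)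
    (hbij : Function.Bijective (fderiv ℝ f a)) :
    ∃ e : OpenPartialHomeomorph E F, a ∈ e.source ∧ e.source ⊆ S ∧ (∀ x, e x = f x) ∧
      ContDiffOn ℝ ∞ e.symm e.target := by
  let L : E ≃L[ℝ] F := ContinuousLinearEquiv.ofBijective (fderiv ℝ f a)
    (LinearMap.ker_eq_bot.2 hbij.1) (LinearMap.range_eq_top.2 hbij.2)
  have hL : (L : E →L[ℝ] F) = fderiv ℝ f a := ContinuousLinearEquiv.coe_ofBijective _ _ _
  have hd : ∀ x ∈ S, ContDiffAt ℝ ∞ f x := fun x hx => hf.contDiffAt (hS.mem_nhds hx)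
  have hstrict : HasStrictFDerivAt f (L : E →L[ℝ] F) a := by
    rw [hL]
    exact (hd a ha).hasStrictFDerivAt (by simp)
  -- Invertible operators form an open set. Shrinking the source to `S ∩ T` makes the derivative
  -- invertible at every point of it, so the inverse is smooth on the whole target and not only at
  -- `f a`.
  let T : Set E := {x | fderiv ℝ f x ∈ range ((↑) : (E ≃L[ℝ] F) → E →L[ℝ] F)}
  have hcont : ContinuousOn (fderiv ℝ f) S := hf.continuousOn_fderiv_of_isOpen hS (by simp)
  have hT : IsOpen (S ∩ T) :=
    hcont.isOpen_inter_preimage hS (ContinuousLinearEquiv.isOpen (𝕜 := ℝ) (E := E) (F := F))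
  have haT : a ∈ S ∩ T := ⟨ha, ⟨L, hL⟩⟩
  let e := (hstrict.toOpenPartialHomeomorph f).restrOpen (S ∩ T) hT
  have hsource : ∀ x ∈ e.source, x ∈ S ∩ T := fun x hx => hx.2
  refine ⟨e, ⟨hstrict.mem_toOpenPartialHomeomorph_source, haT⟩, fun x hx => (hsource x hx).1,
    fun x => rfl, ?_⟩
  intro y hy
  have hx := e.map_target hy
  obtain ⟨M, hM⟩ := (hsource _ hx).2
  have hdx := hd _ (hsource _ hx).1
  refine (e.contDiffAt_symm (f₀' := M) hy ?_ hdx).contDiffWithinAt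
  rw [hM]
  exact (hdx.differentiableAt (by simp)).hasFDerivAt

/-- If finitely many relatively closed sets cover a nonempty open set, one of them contains a
nonempty open subset of it. -/
theorem exists_isOpen_subset_of_cover {Y ι : Type*} [TopologicalSpace Y] [BaireSpace Y]
    [Countable ι] {W : Set Y} (hW : IsOpen W) (hne : W.Nonempty) (C : ι → Set Y)
    (hC : ∀ i, IsOpen (W \ C i)) (hcov : W ⊆ ⋃ i, C i) :
    ∃ i, ∃ W', IsOpen W' ∧ W'.Nonempty ∧ W' ⊆ W ∧ W' ⊆ C i := by
  -- The sets `C i` are closed only relative to `W`. Adding the complement of `W` gives closed sets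
  -- that cover the space and meet `W` only inside `C i`. Nonemptiness of `W` supplies an index for
  -- the points outside `W`.
  have hu : ⋃ i, (W \ C i)ᶜ ∪ Wᶜ = univ := by
    refine eq_univ_of_forall fun x => ?_
    by_cases hx : x ∈ W
    · obtain ⟨i, hi⟩ := mem_iUnion.1 (hcov hx)
      exact mem_iUnion.2 ⟨i, Or.inl fun h => h.2 hi⟩
    · obtain ⟨y, hy⟩ := hne
      obtain ⟨i, -⟩ := mem_iUnion.1 (hcov hy)
      exact mem_iUnion.2 ⟨i, Or.inr hx⟩
  have hcl : ∀ i, IsClosed ((W \ C i)ᶜ ∪ Wᶜ) := fun i =>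
    (hC i).isClosed_compl.union hW.isClosed_compl
  obtain ⟨x, hx, hxW⟩ := (dense_iUnion_interior_of_closed hcl hu).inter_open_nonempty W hW hne
  obtain ⟨i, hi⟩ := mem_iUnion.1 hxW
  refine ⟨i, interior ((W \ C i)ᶜ ∪ Wᶜ) ∩ W, isOpen_interior.inter hW, ⟨x, hi, hx⟩,
    inter_subset_right, ?_⟩
  rintro y ⟨hy, hyW⟩
  by_contra hyC
  rcases interior_subset hy with h | h
  · exact h ⟨hyW, hyC⟩
  · exact h hyW

end Calculus

/-! ### Finite smooth actions on a ball -/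

namespace OrbChart

variable {X : Type u} [TopologicalSpace X] {p : X} (A : OrbChart.{u, v} p)

theorem isOpen_V : IsOpen A.V := Metric.isOpen_ball

theorem zero_mem_V : (0 : OrbModel A.dim) ∈ A.V := Metric.mem_ball_self A.radius_pos

theorem isPreconnected_V : IsPreconnected A.V := (convex_ball _ _).isPreconnected

theorem proj_zero : A.proj 0 = p := (A.proj_eq_iff 0 A.zero_mem_V).2 rfl

theorem mem_image_self : p ∈ A.image := ⟨0, A.zero_mem_V, A.proj_zero⟩

theorem isOpen_image : IsOpen A.image := A.proj_open _ subset_rfl A.isOpen_V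

variable {A}

theorem act_mem_V (g : A.Grp) {x : OrbModel A.dim} (hx : x ∈ A.V) : A.act g x ∈ A.V :=
  A.act_mem g x hx

theorem proj_act (g : A.Grp) {x : OrbModel A.dim} (hx : x ∈ A.V) :
    A.proj (A.act g x) = A.proj x :=
  ((A.proj_eq_proj_iff x hx _ (act_mem_V g hx)).2 ⟨g, rfl⟩).symm

theorem act_zero (g : A.Grp) : A.act g 0 = 0 :=
  (A.proj_eq_iff _ (act_mem_V g A.zero_mem_V)).1 (by rw [proj_act g A.zero_mem_V, proj_zero])

theorem act_mul' (g h : A.Grp) {x : OrbModel A.dim} (hx : x ∈ A.V) :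
    A.act (g * h) x = A.act g (A.act h x) := A.act_mul g h x hx

theorem act_inv_act (g : A.Grp) {x : OrbModel A.dim} (hx : x ∈ A.V) :
    A.act g⁻¹ (A.act g x) = x := by
  rw [← act_mul' _ _ hx, inv_mul_cancel, A.act_one x hx]

theorem act_act_inv (g : A.Grp) {x : OrbModel A.dim} (hx : x ∈ A.V) :
    A.act g (A.act g⁻¹ x) = x := by
  rw [← act_mul' _ _ hx, mul_inv_cancel, A.act_one x hx]

theorem act_inv_eq (g : A.Grp) {x : OrbModel A.dim} (hx : x ∈ A.V) (h : A.act g x = x) :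
    A.act g⁻¹ x = x := by
  conv_lhs => rw [← h]
  exact act_inv_act g hx

theorem act_injOn (g : A.Grp) : InjOn (A.act g) A.V := fun x hx y hy h => by
  rw [← act_inv_act g hx, h, act_inv_act g hy]

theorem contDiffAt_act (g : A.Grp) {x : OrbModel A.dim} (hx : x ∈ A.V) :
    ContDiffAt ℝ ∞ (A.act g) x := (A.act_smooth g).contDiffAt (A.isOpen_V.mem_nhds hx)

theorem continuousAt_act (g : A.Grp) {x : OrbModel A.dim} (hx : x ∈ A.V) :
    ContinuousAt (A.act g) x := (contDiffAt_act g hx).continuousAt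

theorem continuousOn_act (g : A.Grp) : ContinuousOn (A.act g) A.V := (A.act_smooth g).continuousOn

theorem differentiableAt_act (g : A.Grp) {x : OrbModel A.dim} (hx : x ∈ A.V) :
    DifferentiableAt ℝ (A.act g) x := (contDiffAt_act g hx).differentiableAt (by simp)

theorem fderiv_act_mul (g h : A.Grp) {x : OrbModel A.dim} (hx : x ∈ A.V) :
    fderiv ℝ (A.act (g * h)) x =
      (fderiv ℝ (A.act g) (A.act h x)).comp (fderiv ℝ (A.act h) x) := by
  rw [← fderiv_comp x (differentiableAt_act g (act_mem_V h hx)) (differentiableAt_act h hx)]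
  apply Filter.EventuallyEq.fderiv_eq
  filter_upwards [A.isOpen_V.mem_nhds hx] with y hy using A.act_mul g h y hy

theorem fderiv_act_one {x : OrbModel A.dim} (hx : x ∈ A.V) :
    fderiv ℝ (A.act 1) x = ContinuousLinearMap.id ℝ _ := by
  rw [← fderiv_id (𝕜 := ℝ) (x := x)]
  apply Filter.EventuallyEq.fderiv_eq
  filter_upwards [A.isOpen_V.mem_nhds hx] with y hy using A.act_one y hy

theorem fderiv_act_inv_comp (g : A.Grp) {x : OrbModel A.dim} (hx : x ∈ A.V) :
    (fderiv ℝ (A.act g⁻¹) (A.act g x)).comp (fderiv ℝ (A.act g) x) =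
      ContinuousLinearMap.id ℝ _ := by
  rw [← fderiv_act_mul g⁻¹ g hx, inv_mul_cancel, fderiv_act_one hx]

theorem fderiv_act_injective (g : A.Grp) {x : OrbModel A.dim} (hx : x ∈ A.V) :
    Function.Injective (fderiv ℝ (A.act g) x) :=
  Function.LeftInverse.injective (g := fderiv ℝ (A.act g⁻¹) (A.act g x)) fun v =>
    DFunLike.congr_fun (fderiv_act_inv_comp g hx) v

theorem fderiv_act_bijective (g : A.Grp) {x : OrbModel A.dim} (hx : x ∈ A.V) :
    Function.Bijective (fderiv ℝ (A.act g) x) :=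
  ⟨fderiv_act_injective g hx,
    (LinearMap.injective_iff_surjective (f := (fderiv ℝ (A.act g) x).toLinearMap)).1
      (fderiv_act_injective g hx)⟩

theorem continuousOn_fderiv_act (g : A.Grp) : ContinuousOn (fderiv ℝ (A.act g)) A.V :=
  (A.act_smooth g).continuousOn_fderiv_of_isOpen A.isOpen_V (by simp)

/-- A group element that fixes a point to first order fixes all points near it. -/
theorem eventually_act_eq_self (g : A.Grp) {x : OrbModel A.dim} (hx : x ∈ A.V)
    (hfix : A.act g x = x) (hd : fderiv ℝ (A.act g) x = ContinuousLinearMap.id ℝ _) :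
    ∀ᶠ y in 𝓝 x, A.act g y = y := by
  have hpow : ∀ i : ℕ, A.act (g ^ i) x = x ∧
      fderiv ℝ (A.act (g ^ i)) x = ContinuousLinearMap.id ℝ _ := by
    intro i
    induction i with
    | zero => simpa using ⟨A.act_one x hx, fderiv_act_one hx⟩
    | succ i ih =>
      rw [pow_succ, act_mul' _ _ hx, fderiv_act_mul _ _ hx, hfix, ih.1, ih.2, hd]
      simp
  set N := orderOf g with hN
  have hNpos : 0 < N := orderOf_pos g
  -- The average of the powers of `g` has the identity as derivative at `x`, so it is injective near
  -- `x`. It also satisfies `s ∘ g = s`, which forces `g y = y` for `y` near `x`.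
  let s : OrbModel A.dim → OrbModel A.dim :=
    fun y => (N : ℝ)⁻¹ • ∑ i ∈ Finset.range N, A.act (g ^ i) y
  have hs : HasStrictFDerivAt s
      ((ContinuousLinearEquiv.refl ℝ (OrbModel A.dim) : _ ≃L[ℝ] _) :
        OrbModel A.dim →L[ℝ] OrbModel A.dim) x := by
    have h1 : HasStrictFDerivAt s ((N : ℝ)⁻¹ • ∑ i ∈ Finset.range N,
        fderiv ℝ (A.act (g ^ i)) x) x := by
      exact (HasStrictFDerivAt.fun_sum (u := Finset.range N) fun i _ =>
        (contDiffAt_act (g ^ i) hx).hasStrictFDerivAt (by simp)).fun_const_smul (N : ℝ)⁻¹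
    convert h1 using 1
    have hN0 : (N : ℝ) ≠ 0 := by exact_mod_cast hNpos.ne'
    ext v : 1
    simp [(hpow _).2, ← Nat.cast_smul_eq_nsmul ℝ, smul_smul, hN0]
  have hinv : ∀ y ∈ A.V, s (A.act g y) = s y := by
    intro y hy
    have h1 : ∀ i, A.act (g ^ i) (A.act g y) = A.act (g ^ (i + 1)) y := fun i => by
      rw [pow_succ, act_mul' _ _ hy]
    -- Splitting off the last or the first term of the sum over `range (N + 1)` gives the sum and
    -- its shift; these agree because `g ^ N = g ^ 0`.
    have h2 := Finset.sum_range_succ (fun i => A.act (g ^ i) y) N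
    rw [Finset.sum_range_succ', hN, pow_orderOf_eq_one, pow_zero] at h2
    simp only [s, h1]
    rw [hN, add_right_cancel h2]
  let e := hs.toOpenPartialHomeomorph s
  have hsrc : e.source ∈ 𝓝 x := e.open_source.mem_nhds hs.mem_toOpenPartialHomeomorph_source
  have hsrc' : ∀ᶠ y in 𝓝 x, A.act g y ∈ e.source :=
    continuousAt_act g hx (by rw [hfix]; exact hsrc)
  filter_upwards [hsrc, hsrc', A.isOpen_V.mem_nhds hx] with y h1 h2 h3
  exact e.injOn h2 h1 (hinv y h3)

/-- A group element that fixes a point to first order acts trivially. -/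
theorem actsTrivially_of_fderiv_eq_id (g : A.Grp) {x : OrbModel A.dim} (hx : x ∈ A.V)
    (hfix : A.act g x = x) (hd : fderiv ℝ (A.act g) x = ContinuousLinearMap.id ℝ _) :
    A.ActsTrivially g := by
  -- The set where the germ of `g` is the identity is open. It is closed in `V`, since at a limit
  -- point continuity gives a fixed point with identity derivative, where `eventually_act_eq_self`
  -- applies. Connectedness of the ball finishes.
  let T : Set (OrbModel A.dim) := {y | ∀ᶠ y' in 𝓝 y, A.act g y' = y'}
  have hT : IsOpen T := isOpen_setOfPred_eventually_nhds
  have key : A.V ⊆ T := by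
    refine A.isPreconnected_V.subset_of_closure_inter_subset hT
      ⟨x, hx, eventually_act_eq_self g hx hfix hd⟩ ?_
    rintro y ⟨hy, hyV⟩
    have hne : (𝓝[T] y).NeBot := mem_closure_iff_nhdsWithin_neBot.1 hy
    have hyfix : A.act g y = y := by
      refine tendsto_nhds_unique (f := A.act g) (l := 𝓝[T] y)
        ((continuousAt_act g hyV).mono_left nhdsWithin_le_nhds) ?_
      refine (tendsto_id.mono_left nhdsWithin_le_nhds).congr' ?_
      filter_upwards [self_mem_nhdsWithin] with z hz using hz.self_of_nhds.symm
    refine eventually_act_eq_self g hyV hyfix ?_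
    refine tendsto_nhds_unique (f := fderiv ℝ (A.act g)) (l := 𝓝[T] y)
      (((continuousOn_fderiv_act g).continuousAt (A.isOpen_V.mem_nhds hyV)).mono_left
        nhdsWithin_le_nhds) ?_
    refine tendsto_const_nhds.congr' ?_
    filter_upwards [self_mem_nhdsWithin] with z hz
    have : A.act g =ᶠ[𝓝 z] id := hz
    rw [this.fderiv_eq, fderiv_id]
  exact fun y hy => (key hy).self_of_nhds

theorem actsTrivially_of_eventually (g : A.Grp) {x : OrbModel A.dim} (hx : x ∈ A.V)
    (h : ∀ᶠ y in 𝓝 x, A.act g y = y) : A.ActsTrivially g := by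
  refine actsTrivially_of_fderiv_eq_id g hx h.self_of_nhds ?_
  have : A.act g =ᶠ[𝓝 x] id := h
  rw [this.fderiv_eq, fderiv_id]

/-- Elements with the same value and the same derivative at a point differ by an element of the
kernel of the action. -/
theorem actsTrivially_inv_mul (g h : A.Grp) {x : OrbModel A.dim} (hx : x ∈ A.V)
    (h0 : A.act g x = A.act h x) (h1 : fderiv ℝ (A.act g) x = fderiv ℝ (A.act h) x) :
    A.ActsTrivially (g⁻¹ * h) := by
  refine actsTrivially_of_fderiv_eq_id _ hx ?_ ?_
  · rw [act_mul' _ _ hx, ← h0, act_inv_act g hx]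
  · rw [fderiv_act_mul _ _ hx, ← h1, ← h0, fderiv_act_inv_comp g hx]

/-- Every nonempty open set contains a point whose stabilizer is the kernel of the action. -/
theorem exists_mem_forall_actsTrivially {W : Set (OrbModel A.dim)} (hW : IsOpen W)
    (hne : W.Nonempty) (hWV : W ⊆ A.V) :
    ∃ x ∈ W, ∀ g, A.act g x = x → A.ActsTrivially g := by
  -- Otherwise the fixed-point sets of the finitely many elements outside the kernel cover `W`. By
  -- Baire one of them has interior points, and that element would act trivially.
  by_contra! hcon
  have hopen : ∀ g : {g : A.Grp // ¬ A.ActsTrivially g}, IsOpen (W \ {x | A.act g x = x}) := by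
    intro g
    refine isOpen_iff_mem_nhds.2 fun x hx => ?_
    have h0 : ∀ᶠ y in 𝓝 x, (A.act g.1 y, y) ∈ (diagonal (OrbModel A.dim))ᶜ :=
      ((continuousAt_act g.1 (hWV hx.1)).prodMk continuousAt_id).eventually
        (isClosed_diagonal.isOpen_compl.mem_nhds hx.2)
    filter_upwards [hW.mem_nhds hx.1, h0] with y h1 h2
    exact ⟨h1, fun h => h2 h⟩
  have hcov : W ⊆ ⋃ g : {g : A.Grp // ¬ A.ActsTrivially g}, {x | A.act g x = x} := by
    intro x hx
    obtain ⟨g, h1, h2⟩ := hcon x hx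
    exact mem_iUnion.2 ⟨⟨g, h2⟩, h1⟩
  obtain ⟨⟨g, hg⟩, W', hW', ⟨x, hx⟩, hW'W, hfix⟩ :=
    exists_isOpen_subset_of_cover hW hne _ hopen hcov
  refine hg (actsTrivially_of_eventually g (hWV (hW'W hx)) ?_)
  filter_upwards [hW'.mem_nhds hx] with y hy using hfix hy

/-- Every neighbourhood of the origin contains a connected invariant open one. -/
theorem exists_connected_invariant {N : Set (OrbModel A.dim)} (hN : N ∈ 𝓝 0) :
    ∃ D, IsOpen D ∧ IsPreconnected D ∧ (0 : OrbModel A.dim) ∈ D ∧ D ⊆ A.V ∧ D ⊆ N ∧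
      ∀ a, ∀ x ∈ D, A.act a x ∈ D := by
  -- The points whose whole orbit lies in `interior N`. Its component at the origin is invariant,
  -- because a group element fixes the origin and maps the component to a connected subset of `M`.
  let M : Set (OrbModel A.dim) := {x | x ∈ A.V ∧ ∀ a, A.act a x ∈ interior N}
  have hM : IsOpen M := isOpen_iff_mem_nhds.2 fun x hx => by
    filter_upwards [A.isOpen_V.mem_nhds hx.1, eventually_all.2 fun a =>
      (continuousAt_act a hx.1).eventually (isOpen_interior.mem_nhds (hx.2 a))] with y h1 h2
    exact ⟨h1, h2⟩
  have h0 : (0 : OrbModel A.dim) ∈ M :=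
    ⟨A.zero_mem_V, fun a => by rw [act_zero]; exact mem_interior_iff_mem_nhds.2 hN⟩
  have hsub : connectedComponentIn M 0 ⊆ M := connectedComponentIn_subset M 0
  refine ⟨connectedComponentIn M 0, hM.connectedComponentIn, isPreconnected_connectedComponentIn,
    mem_connectedComponentIn h0, fun x hx => (hsub hx).1, fun x hx => ?_, fun a => ?_⟩
  · have := (hsub hx).2 1
    rw [A.act_one x (hsub hx).1] at this
    exact interior_subset this
  · have himg : A.act a '' connectedComponentIn M 0 ⊆ connectedComponentIn M 0 := by
      refine IsPreconnected.subset_connectedComponentIn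
        (isPreconnected_connectedComponentIn.image _
          ((continuousOn_act a).mono fun x hx => (hsub hx).1))
        ⟨0, mem_connectedComponentIn h0, act_zero a⟩ ?_
      rintro _ ⟨x, hx, rfl⟩
      refine ⟨act_mem_V a (hsub hx).1, fun b => ?_⟩
      rw [← act_mul' _ _ (hsub hx).1]
      exact (hsub hx).2 _
    exact fun x hx => himg ⟨x, hx, rfl⟩

/-- The stabilizer of a point. -/
def stab (y : OrbModel A.dim) (hy : y ∈ A.V) : Subgroup A.Grp where
  carrier := {g | A.act g y = y}
  one_mem' := A.act_one y hy
  mul_mem' {a b} ha hb := by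
    change A.act (a * b) y = y
    rw [act_mul' _ _ hy, show A.act b y = y from hb, show A.act a y = y from ha]
  inv_mem' {a} ha := act_inv_eq a hy ha

/-- Near any point, the action of the stabilizer is conjugate to its tangent action. -/
theorem exists_linearization {y : OrbModel A.dim} (hy : y ∈ A.V) :
    ∃ e : OpenPartialHomeomorph (OrbModel A.dim) (OrbModel A.dim),
      y ∈ e.source ∧ e y = 0 ∧ e.source ⊆ A.V ∧ ContDiffOn ℝ ∞ e e.source ∧
      ContDiffOn ℝ ∞ e.symm e.target ∧
      fderiv ℝ e y = ContinuousLinearMap.id ℝ _ ∧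
      (∀ g, A.act g y = y → ∀ x ∈ e.source, A.act g x ∈ e.source ∧
        e (A.act g x) = fderiv ℝ (A.act g) y (e x)) := by
  classical
  let H := stab y hy
  have : Fintype H := Fintype.ofFinite H
  have hH : ∀ h : H, A.act h.1 y = y := fun h => h.2
  set N := Fintype.card H with hN
  have hN0 : (N : ℝ) ≠ 0 := by exact_mod_cast Fintype.card_ne_zero
  -- Bochner's average of `dh⁻¹ ∘ (h - y)` over the stabilizer. Its derivative at `y` is the
  -- identity, and the substitution `h ↦ h g` shows `s ∘ g = dg ∘ s`.
  let s : OrbModel A.dim → OrbModel A.dim :=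
    fun x => (N : ℝ)⁻¹ • ∑ h : H, fderiv ℝ (A.act (h⁻¹).1) y (A.act h.1 x - y)
  have hs0 : s y = 0 := by simp [s, hH]
  have hsm : ContDiffOn ℝ ∞ s A.V := by
    refine ContDiffOn.const_smul _ (ContDiffOn.sum fun h _ => ?_)
    exact (ContinuousLinearMap.contDiff _).comp_contDiffOn
      ((A.act_smooth h.1).sub contDiffOn_const)
  have hsd : HasFDerivAt s (ContinuousLinearMap.id ℝ (OrbModel A.dim)) y := by
    have h1 : HasFDerivAt s ((N : ℝ)⁻¹ • ∑ h : H,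
        (fderiv ℝ (A.act (h⁻¹).1) y).comp (fderiv ℝ (A.act h.1) y)) y := by
      exact (HasFDerivAt.fun_sum (u := Finset.univ) fun h _ =>
        (ContinuousLinearMap.hasFDerivAt _).comp y
          ((differentiableAt_act h.1 hy).hasFDerivAt.sub_const _)).fun_const_smul (N : ℝ)⁻¹
    convert h1 using 1
    have h2 : ∀ h : H, (fderiv ℝ (A.act (h⁻¹).1) y).comp (fderiv ℝ (A.act h.1) y) =
        ContinuousLinearMap.id ℝ _ := fun h => by
      have := fderiv_act_inv_comp h.1 hy
      rwa [hH h] at this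
    simp only [h2]
    ext v : 1
    simp [← Nat.cast_smul_eq_nsmul ℝ, smul_smul, hN0, ← hN]
  have hequiv : ∀ g : H, ∀ x ∈ A.V, s (A.act g.1 x) = fderiv ℝ (A.act g.1) y (s x) := by
    intro g x hx
    simp only [s, map_smul, map_sum]
    congr 1
    refine Fintype.sum_equiv (Equiv.mulRight g) _ _ fun h => ?_
    have h1 : fderiv ℝ (A.act (h⁻¹).1) y =
        (fderiv ℝ (A.act g.1) y).comp (fderiv ℝ (A.act ((h * g)⁻¹).1) y) := by
      have h2 := fderiv_act_mul g.1 ((h * g)⁻¹).1 hy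
      rw [hH] at h2
      rw [← h2]
      congr 2
      simp
    rw [h1, ← act_mul' _ _ hx]
    rfl
  obtain ⟨e, hye, heV, hes, hsymm⟩ := exists_openPartialHomeomorph_of_bijective_fderiv
    A.isOpen_V hy hsm (by rw [hsd.fderiv]; exact Function.bijective_id)
  -- Keeping only the points whose orbit under the stabilizer stays in the source makes the source
  -- invariant.
  let M : Set (OrbModel A.dim) := {x | x ∈ A.V ∧ ∀ h : H, A.act h.1 x ∈ e.source}
  have hM : IsOpen M := isOpen_iff_mem_nhds.2 fun x hx => by
    filter_upwards [A.isOpen_V.mem_nhds hx.1, eventually_all.2 fun a : H =>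
      (continuousAt_act a.1 hx.1).eventually (e.open_source.mem_nhds (hx.2 a))] with y h1 h2
    exact ⟨h1, h2⟩
  have hfun : (e : OrbModel A.dim → OrbModel A.dim) = s := funext hes
  refine ⟨e.restrOpen M hM, ⟨hye, hy, fun h => by rwa [hH h]⟩, ?_, fun x hx => hx.2.1, ?_,
    ?_, ?_, ?_⟩
  · exact (hes y).trans hs0
  · change ContDiffOn ℝ ∞ e _
    rw [hfun]
    exact hsm.mono fun x hx => hx.2.1
  · exact hsymm.mono fun x hx => hx.1
  · change fderiv ℝ e y = _
    rw [hfun, hsd.fderiv]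
  · intro g hg x hx
    refine ⟨⟨hx.2.2 ⟨g, hg⟩, act_mem_V g hx.2.1, fun h => ?_⟩, ?_⟩
    · rw [← act_mul' _ _ hx.2.1]
      exact hx.2.2 (h * ⟨g, hg⟩)
    · change e _ = fderiv ℝ (A.act g) y (e x)
      rw [hfun]
      exact hequiv ⟨g, hg⟩ x hx.2.1

end OrbChart

/-! ### Rigidity of injections -/

namespace OrbInjection

variable {X : Type u} [TopologicalSpace X] {q p : X} {A : OrbChart.{u, v} q} {B : OrbChart.{u, v} p}

theorem dom_mem_nhds (φ : OrbInjection A B) : φ.dom ∈ 𝓝 (0 : OrbModel A.dim) :=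
  φ.dom_open.mem_nhds φ.zero_mem_dom

theorem contDiffAt (φ : OrbInjection A B) {x : OrbModel A.dim} (hx : x ∈ φ.dom) :
    ContDiffAt ℝ ∞ φ.toFun x := φ.smooth.contDiffAt (φ.dom_open.mem_nhds hx)

theorem differentiableAt (φ : OrbInjection A B) {x : OrbModel A.dim} (hx : x ∈ φ.dom) :
    DifferentiableAt ℝ φ.toFun x := (φ.contDiffAt hx).differentiableAt (by simp)

theorem continuousAt_zero (φ : OrbInjection A B) : ContinuousAt φ.toFun 0 :=
  (φ.contDiffAt φ.zero_mem_dom).continuousAt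

theorem map_zero_mem (φ : OrbInjection A B) : φ.toFun 0 ∈ B.V := φ.mapsTo φ.zero_mem_dom

theorem proj_map_zero (φ : OrbInjection A B) : B.proj (φ.toFun 0) = q := by
  rw [φ.proj_comp 0 φ.zero_mem_dom, A.proj_zero]

theorem mem_image (φ : OrbInjection A B) : q ∈ B.image := ⟨_, φ.map_zero_mem, φ.proj_map_zero⟩

theorem act_hom_map_zero (φ : OrbInjection A B) (a : A.Grp) :
    B.act (φ.hom a) (φ.toFun 0) = φ.toFun 0 := by
  rw [← φ.equivariant a 0 φ.zero_mem_dom, OrbChart.act_zero]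

theorem dim_eq (φ : OrbInjection A B) : A.dim = B.dim := by
  have h := LinearEquiv.finrank_eq (LinearEquiv.ofBijective (fderiv ℝ φ.toFun 0).toLinearMap
    (φ.fderiv_bijective 0 φ.zero_mem_dom))
  simpa using h

theorem map_nhds_eq (φ : OrbInjection A B) {x : OrbModel A.dim} (hx : x ∈ φ.dom) :
    map φ.toFun (𝓝 x) = 𝓝 (φ.toFun x) :=
  ((φ.contDiffAt hx).hasStrictFDerivAt (by simp)).map_nhds_eq_of_surj
    (LinearMap.range_eq_top.2 (φ.fderiv_bijective x hx).2)

/-- The image of `τ` is the stabilizer of `ψ(0)`. -/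
theorem exists_hom_eq (φ : OrbInjection A B) {b : B.Grp}
    (hb : B.act b (φ.toFun 0) = φ.toFun 0) : ∃ a, φ.hom a = b := by
  have h1 : ∀ᶠ y in 𝓝 (φ.toFun 0), y ∈ φ.toFun '' φ.dom := by
    rw [← φ.map_nhds_eq φ.zero_mem_dom]
    exact image_mem_map φ.dom_mem_nhds
  have h2 : ∀ᶠ y in 𝓝 (φ.toFun 0), B.act b y ∈ φ.toFun '' φ.dom :=
    OrbChart.continuousAt_act b φ.map_zero_mem (by rw [hb]; exact h1)
  obtain ⟨W, hW, hWo, h0⟩ := eventually_nhds_iff.1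
    ((h1.and h2).and (B.isOpen_V.eventually_mem φ.map_zero_mem))
  -- Choose `y = ψ(x)` near `ψ(0)` whose stabilizer is the kernel, with `b y` still in the image of
  -- `ψ`. Then `b y = ψ(a x) = τ(a) y` for some `a`, so `b` and `τ(a)` differ by a kernel element,
  -- which lies in the image of `τ` by `hom_kernel`.
  obtain ⟨y, hy, hstab⟩ := OrbChart.exists_mem_forall_actsTrivially hWo ⟨_, h0⟩
    fun y hy => (hW y hy).2
  obtain ⟨⟨⟨x, hx, hxy⟩, x', hx', hxy'⟩, hyV⟩ := hW y hy
  have hproj : A.proj x = A.proj x' := by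
    rw [← φ.proj_comp x hx, ← φ.proj_comp x' hx', hxy', OrbChart.proj_act b hyV, hxy]
  obtain ⟨a, ha⟩ := (A.proj_eq_proj_iff x (φ.dom_subset hx) x' (φ.dom_subset hx')).1 hproj
  have h3 : B.act (b⁻¹ * φ.hom a) y = y := by
    rw [OrbChart.act_mul' _ _ hyV]
    conv_lhs => rw [← hxy, ← φ.equivariant a x hx, ha, hxy']
    exact OrbChart.act_inv_act b hyV
  obtain ⟨a', -, ha'⟩ := (φ.hom_kernel _).1 (hstab _ h3)
  refine ⟨a * a'⁻¹, ?_⟩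
  rw [map_mul, map_inv, ha']
  group

/-- A germ of an equivariant smooth open embedding over the identity of `X` is the germ of an
injection. -/
theorem exists_of_germ (f : OrbModel A.dim → OrbModel B.dim) (τ : A.Grp →* B.Grp)
    (hsmooth : ∀ᶠ x in 𝓝 (0 : OrbModel A.dim), ContDiffAt ℝ ∞ f x)
    (hbij : ∀ᶠ x in 𝓝 (0 : OrbModel A.dim), Function.Bijective (fderiv ℝ f x))
    (hinj : ∃ N ∈ 𝓝 (0 : OrbModel A.dim), InjOn f N)
    (hmaps : ∀ᶠ x in 𝓝 (0 : OrbModel A.dim), f x ∈ B.V)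
    (hequiv : ∀ᶠ x in 𝓝 (0 : OrbModel A.dim), ∀ a, f (A.act a x) = B.act (τ a) (f x))
    (hproj : ∀ᶠ x in 𝓝 (0 : OrbModel A.dim), B.proj (f x) = A.proj x)
    (hτ : Function.Injective τ)
    (hker : ∀ b, B.ActsTrivially b ↔ ∃ a, A.ActsTrivially a ∧ τ a = b) :
    ∃ φ : OrbInjection A B, φ.toFun = f ∧ φ.hom = τ := by
  obtain ⟨N, hN, hfN⟩ := hinj
  replace hN : ∀ᶠ x in 𝓝 (0 : OrbModel A.dim), x ∈ N := hN
  obtain ⟨D, hDo, hDc, hD0, hDV, hDsub, hDinv⟩ := OrbChart.exists_connected_invariant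
    (A := A) (hsmooth.and (hbij.and (hN.and (hmaps.and (hequiv.and hproj)))))
  exact ⟨{
    dom := D
    dom_open := hDo
    dom_connected := hDc
    zero_mem_dom := hD0
    dom_subset := hDV
    dom_invariant := hDinv
    toFun := f
    mapsTo := fun x hx => (hDsub hx).2.2.2.1
    smooth := fun x hx => (hDsub hx).1.contDiffWithinAt
    injOn := hfN.mono fun x hx => (hDsub hx).2.2.1
    fderiv_bijective := fun x hx => (hDsub hx).2.1
    hom := τ
    hom_injective := hτ
    hom_kernel := hker
    equivariant := fun a x hx => (hDsub hx).2.2.2.2.1 a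
    proj_comp := fun x hx => (hDsub hx).2.2.2.2.2 }, rfl, rfl⟩

/-- The identity injection. -/
def refl (A : OrbChart.{u, v} q) : OrbInjection A A where
  dom := A.V
  dom_open := A.isOpen_V
  dom_connected := A.isPreconnected_V
  zero_mem_dom := A.zero_mem_V
  dom_subset := subset_rfl
  dom_invariant a x hx := OrbChart.act_mem_V a hx
  toFun := id
  mapsTo := mapsTo_id _
  smooth := contDiffOn_id
  injOn := injOn_id _
  fderiv_bijective x hx := by
    rw [fderiv_id]
    exact Function.bijective_id
  hom := MonoidHom.id _
  hom_injective := Function.injective_id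
  hom_kernel b := by simp
  equivariant _ _ _ := rfl
  proj_comp _ _ := rfl

/-- Composition of an injection with the automorphism of the target given by a group element. -/
def smul (g : B.Grp) (φ : OrbInjection A B) : OrbInjection A B where
  dom := φ.dom
  dom_open := φ.dom_open
  dom_connected := φ.dom_connected
  zero_mem_dom := φ.zero_mem_dom
  dom_subset := φ.dom_subset
  dom_invariant := φ.dom_invariant
  toFun := fun x => B.act g (φ.toFun x)
  mapsTo x hx := OrbChart.act_mem_V g (φ.mapsTo hx)
  smooth := (B.act_smooth g).comp φ.smooth φ.mapsTo
  injOn x hx y hy h := φ.injOn hx hy (OrbChart.act_injOn g (φ.mapsTo hx) (φ.mapsTo hy) h)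
  fderiv_bijective x hx := by
    have := fderiv_comp x (OrbChart.differentiableAt_act g (φ.mapsTo hx)) (φ.differentiableAt hx)
    rw [show (fun x => B.act g (φ.toFun x)) = B.act g ∘ φ.toFun from rfl, this]
    exact (OrbChart.fderiv_act_bijective g (φ.mapsTo hx)).comp (φ.fderiv_bijective x hx)
  hom := (MulAut.conj g).toMonoidHom.comp φ.hom
  hom_injective := (MulAut.conj g).injective.comp φ.hom_injective
  hom_kernel b := by
    -- The kernel of the action is normal.
    have hconj : B.ActsTrivially b ↔ B.ActsTrivially (g⁻¹ * b * g) := by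
      constructor
      · intro h x hx
        rw [mul_assoc, OrbChart.act_mul' _ _ hx, OrbChart.act_mul' _ _ hx,
          h _ (OrbChart.act_mem_V g hx), OrbChart.act_inv_act g hx]
      · intro h x hx
        have := h _ (OrbChart.act_mem_V g⁻¹ hx)
        rw [mul_assoc, OrbChart.act_mul' _ _ (OrbChart.act_mem_V g⁻¹ hx),
          OrbChart.act_mul' _ _ (OrbChart.act_mem_V g⁻¹ hx), OrbChart.act_act_inv g hx] at this
        exact OrbChart.act_injOn g⁻¹ (OrbChart.act_mem_V b hx) hx this
    rw [hconj, φ.hom_kernel]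
    refine exists_congr fun a => and_congr_right fun _ => ?_
    simp only [MonoidHom.comp_apply, MulEquiv.toMonoidHom_eq_coe, MonoidHom.coe_coe,
      MulAut.conj_apply]
    constructor
    · intro h
      rw [h]
      group
    · intro h
      rw [← h]
      group
  equivariant a x hx := by
    simp only [MonoidHom.comp_apply, MulEquiv.toMonoidHom_eq_coe, MonoidHom.coe_coe,
      MulAut.conj_apply]
    rw [φ.equivariant a x hx, ← OrbChart.act_mul' _ _ (φ.mapsTo hx),
      ← OrbChart.act_mul' _ _ (φ.mapsTo hx)]
    congr 1
    group
  proj_comp x hx := by rw [OrbChart.proj_act g (φ.mapsTo hx), φ.proj_comp x hx]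

@[simp] theorem smul_toFun (g : B.Grp) (φ : OrbInjection A B) (x : OrbModel A.dim) :
    (smul g φ).toFun x = B.act g (φ.toFun x) := rfl

@[simp] theorem smul_hom (g : B.Grp) (φ : OrbInjection A B) (a : A.Grp) :
    (smul g φ).hom a = g * φ.hom a * g⁻¹ := rfl

/-- Injections can be composed where this makes sense. -/
theorem exists_comp {r : X} {C : OrbChart.{u, v} r} (χ : OrbInjection A B) (φ : OrbInjection C A)
    (h0 : φ.toFun 0 ∈ χ.dom) :
    ∃ η : OrbInjection C B, η.toFun = χ.toFun ∘ φ.toFun ∧ η.hom = χ.hom.comp φ.hom := by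
  have h1 : ∀ᶠ x in 𝓝 (0 : OrbModel C.dim), φ.toFun x ∈ χ.dom :=
    φ.continuousAt_zero (χ.dom_open.mem_nhds h0)
  have h2 : ∀ᶠ x in 𝓝 (0 : OrbModel C.dim), x ∈ φ.dom := φ.dom_mem_nhds
  apply exists_of_germ
  · filter_upwards [h1, h2] with x hx1 hx2 using (χ.contDiffAt hx1).comp x (φ.contDiffAt hx2)
  · filter_upwards [h1, h2] with x hx1 hx2
    rw [fderiv_comp x (χ.differentiableAt hx1) (φ.differentiableAt hx2)]
    exact (χ.fderiv_bijective _ hx1).comp (φ.fderiv_bijective x hx2)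
  · exact ⟨_, h1.and h2, fun x hx y hy h => φ.injOn hx.2 hy.2 (χ.injOn hx.1 hy.1 h)⟩
  · filter_upwards [h1] with x hx1 using χ.mapsTo hx1
  · filter_upwards [h1, h2] with x hx1 hx2 a
    simp only [Function.comp_apply, MonoidHom.comp_apply]
    rw [φ.equivariant a x hx2, χ.equivariant _ _ hx1]
  · filter_upwards [h1, h2] with x hx1 hx2
    rw [Function.comp_apply, χ.proj_comp _ hx1, φ.proj_comp x hx2]
  · exact χ.hom_injective.comp φ.hom_injective
  · intro b
    rw [χ.hom_kernel]
    constructor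
    · rintro ⟨a, ha, rfl⟩
      obtain ⟨c, hc, rfl⟩ := (φ.hom_kernel a).1 ha
      exact ⟨c, hc, rfl⟩
    · rintro ⟨c, hc, rfl⟩
      exact ⟨φ.hom c, (φ.hom_kernel _).2 ⟨c, hc, rfl⟩, rfl⟩

/-- Two injections between the same systems differ near the origin by a group element. -/
theorem exists_eventually_eq_act (φ ψ : OrbInjection A B) :
    ∃ g, ∀ᶠ x in 𝓝 (0 : OrbModel A.dim), ψ.toFun x = B.act g (φ.toFun x) := by
  set D := φ.dom ∩ ψ.dom with hD
  have hDo : IsOpen D := φ.dom_open.inter ψ.dom_open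
  have h0D : (0 : OrbModel A.dim) ∈ D := ⟨φ.zero_mem_dom, ψ.zero_mem_dom⟩
  -- `P g x` says that `ψ` and `g ∘ φ` have the same germ at `x`. Pointwise some `g` works
  -- everywhere on `D`, so by Baire `P g x` holds for some `g` and some `x` in each nonempty open
  -- subset.
  let P : B.Grp → OrbModel A.dim → Prop :=
    fun g x => ∀ᶠ x' in 𝓝 x, ψ.toFun x' = B.act g (φ.toFun x')
  have hcov : ∀ x ∈ D, ∃ g, ψ.toFun x = B.act g (φ.toFun x) := by
    rintro x ⟨h1, h2⟩
    obtain ⟨g, hg⟩ := (B.proj_eq_proj_iff _ (φ.mapsTo h1) _ (ψ.mapsTo h2)).1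
      (by rw [φ.proj_comp x h1, ψ.proj_comp x h2])
    exact ⟨g, hg.symm⟩
  have hcontφ : ContinuousOn φ.toFun D := φ.smooth.continuousOn.mono inter_subset_left
  have hcontψ : ContinuousOn ψ.toFun D := ψ.smooth.continuousOn.mono inter_subset_right
  have hcontg : ∀ g, ContinuousOn (fun x => B.act g (φ.toFun x)) D := fun g =>
    (OrbChart.continuousOn_act g).comp hcontφ fun x hx => φ.mapsTo hx.1
  have hne : ∀ g, ∀ N ⊆ D, IsOpen N → IsOpen (N \ {x | ψ.toFun x = B.act g (φ.toFun x)}) := by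
    intro g N hND hN
    have := ((hcontψ.mono hND).prodMk ((hcontg g).mono hND)).isOpen_inter_preimage hN
      (isClosed_diagonal (X := OrbModel B.dim)).isOpen_compl
    exact this
  have hbaire : ∀ W ⊆ D, IsOpen W → W.Nonempty → ∃ g, ∃ x ∈ W, P g x := by
    intro W hWD hW hWne
    obtain ⟨g, W', hW', ⟨x, hx⟩, hW'W, hfix⟩ := exists_isOpen_subset_of_cover hW hWne
      (fun g : B.Grp => {x | ψ.toFun x = B.act g (φ.toFun x)}) (fun g => hne g W hWD hW)
      fun x hx => mem_iUnion.2 (hcov x (hWD hx))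
    refine ⟨g, x, hW'W hx, ?_⟩
    filter_upwards [hW'.mem_nhds hx] with y hy using hfix hy
  -- If such germs accumulate at the origin, then by continuity `ψ` and `g ∘ φ` agree there to first
  -- order.
  have hlim : ∀ g, (∃ᶠ x in 𝓝 (0 : OrbModel A.dim), P g x) →
      ψ.toFun 0 = B.act g (φ.toFun 0) ∧
      fderiv ℝ ψ.toFun 0 = (fderiv ℝ (B.act g) (φ.toFun 0)).comp (fderiv ℝ φ.toFun 0) := by
    intro g hg
    have hg1 : ContDiffOn ℝ ∞ (fun x => B.act g (φ.toFun x)) D :=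
      ((B.act_smooth g).comp φ.smooth φ.mapsTo).mono inter_subset_left
    have hfr : (𝓝[{x | P g x}] (0 : OrbModel A.dim)).NeBot :=
      mem_closure_iff_nhdsWithin_neBot.1 (mem_closure_iff_frequently.2 hg)
    have hDn := hDo.mem_nhds h0D
    constructor
    · refine tendsto_nhds_unique (f := ψ.toFun) (l := 𝓝[{x | P g x}] 0)
        ((hcontψ.continuousAt hDn).mono_left nhdsWithin_le_nhds) ?_
      refine (((hcontg g).continuousAt hDn).mono_left nhdsWithin_le_nhds).congr' ?_
      filter_upwards [self_mem_nhdsWithin] with x hx using hx.self_of_nhds.symm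
    · have h1 := (ψ.smooth.mono (inter_subset_right : D ⊆ _)).continuousOn_fderiv_of_isOpen hDo
        (by simp)
      have h2 := hg1.continuousOn_fderiv_of_isOpen hDo (by simp)
      rw [← fderiv_comp 0 (OrbChart.differentiableAt_act g φ.map_zero_mem)
        (φ.differentiableAt φ.zero_mem_dom)]
      refine tendsto_nhds_unique (f := fderiv ℝ ψ.toFun) (l := 𝓝[{x | P g x}] 0)
        ((h1.continuousAt hDn).mono_left nhdsWithin_le_nhds) ?_
      refine ((h2.continuousAt hDn).mono_left nhdsWithin_le_nhds).congr' ?_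
      filter_upwards [self_mem_nhdsWithin] with x hx
      exact (Filter.EventuallyEq.fderiv_eq hx).symm
  -- As the group is finite, `N` can be chosen so small that every `g` whose germs occur in `N` has
  -- germs accumulating at the origin.
  obtain ⟨N, hN, hNo, h0N⟩ := eventually_nhds_iff.1 ((hDo.eventually_mem h0D).and
    (eventually_all.2 fun g : B.Grp => show ∀ᶠ x in 𝓝 (0 : OrbModel A.dim),
      (¬ ∃ᶠ x in 𝓝 (0 : OrbModel A.dim), P g x) → ¬ P g x by
        by_cases h : ∃ᶠ x in 𝓝 (0 : OrbModel A.dim), P g x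
        · exact Eventually.of_forall fun x h' => (h' h).elim
        · exact (not_frequently.1 h).mono fun x hx _ => hx))
  obtain ⟨g, x, hx, hgx⟩ := hbaire N (fun x hx => (hN x hx).1) hNo ⟨0, h0N⟩
  have hg := hlim g (by_contra fun h => (hN x hx).2 g h hgx)
  refine ⟨g, ?_⟩
  filter_upwards [hNo.mem_nhds h0N] with x hx
  by_contra hxne
  have hWN : N \ {x | ψ.toFun x = B.act g (φ.toFun x)} ⊆ N := sdiff_subset
  obtain ⟨g', y, hy, hgy⟩ := hbaire (N \ {x | ψ.toFun x = B.act g (φ.toFun x)})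
    (fun x hx => (hN x hx.1).1) (hne g N (fun x hx => (hN x hx).1) hNo) ⟨x, hx, hxne⟩
  have hg' := hlim g' (by_contra fun h => (hN y hy.1).2 g' h hgy)
  -- If `ψ ≠ g ∘ φ` somewhere in `N`, a germ with some `g'` occurs inside the open set of
  -- disagreement. Both `g` and `g'` match `ψ` to first order at the origin, so they have the same
  -- action, a contradiction.
  have htriv : B.ActsTrivially (g⁻¹ * g') := by
    refine OrbChart.actsTrivially_inv_mul g g' φ.map_zero_mem (hg.1.symm.trans hg'.1) ?_
    ext1 v
    obtain ⟨v, rfl⟩ := (φ.fderiv_bijective 0 φ.zero_mem_dom).2 v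
    exact DFunLike.congr_fun (hg.2.symm.trans hg'.2) v
  have hyV : φ.toFun y ∈ B.V := φ.mapsTo (hN y hy.1).1.1
  refine hy.2 ?_
  change ψ.toFun y = _
  have h1 := congrArg (B.act g) (htriv _ hyV)
  rw [← OrbChart.act_mul' _ _ hyV, mul_inv_cancel_left] at h1
  rw [hgy.self_of_nhds, h1]

end OrbInjection

/-! ### Uniqueness of the patching for effective actions -/

/-- For reduced orbifolds the patching injections are determined by the uniformizing systems. -/
theorem OrbAtlas.Reduced.existsUnique {X : Type u} [TopologicalSpace X] {A : OrbAtlas.{u, v} X}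
    (hA : A.Reduced) : ∃! O : Orbifold.{u, v} X, O.toOrbAtlas = A := by
  have hrigid : ∀ {q p} (φ ψ : OrbInjection (A.chart q) (A.chart p)), ∃ g : (A.chart p).Grp,
      (∀ᶠ x in 𝓝 (0 : OrbModel (A.chart q).dim), ψ.toFun x = (A.chart p).act g (φ.toFun x)) ∧
      ∀ a, ψ.hom a = g * φ.hom a * g⁻¹ := by
    intro q p φ ψ
    obtain ⟨g, hg⟩ := φ.exists_eventually_eq_act ψ
    refine ⟨g, hg, fun a => ?_⟩
    have hga : ∀ᶠ x in 𝓝 (0 : OrbModel (A.chart q).dim),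
        ψ.toFun ((A.chart q).act a x) = (A.chart p).act g (φ.toFun ((A.chart q).act a x)) := by
      refine (OrbChart.continuousAt_act a (A.chart q).zero_mem_V).eventually
        (p := fun x => ψ.toFun x = (A.chart p).act g (φ.toFun x)) ?_
      rwa [OrbChart.act_zero]
    -- Equivariance of the two sides of `ψ = g ∘ φ` shows that `ψ.hom a * g` and `g * φ.hom a` act
    -- equally near `φ(0)`. Effectiveness turns this into an equality in the group.
    have h1 : ∀ᶠ y in 𝓝 (φ.toFun 0),
        (A.chart p).act ((g * φ.hom a)⁻¹ * (ψ.hom a * g)) y = y := by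
      rw [← φ.map_nhds_eq φ.zero_mem_dom, eventually_map]
      filter_upwards [hg, hga, φ.dom_mem_nhds, ψ.dom_mem_nhds] with x h1 h2 h3 h4
      have hV := φ.mapsTo h3
      rw [ψ.equivariant a x h4, φ.equivariant a x h3, h1, ← OrbChart.act_mul' _ _ hV,
        ← OrbChart.act_mul' _ _ hV] at h2
      rw [OrbChart.act_mul' _ _ hV, h2, OrbChart.act_inv_act _ hV]
    have h2 := hA p _ (OrbChart.actsTrivially_of_eventually _ φ.map_zero_mem h1)
    rw [inv_mul_eq_one] at h2
    rw [h2]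
    group
  -- All injections are taken as patching injections. Rigidity puts them into one class, so any
  -- nonempty class closed under the group, as required by the axioms, contains all of them.
  refine ⟨{ toOrbAtlas := A
            inj := fun _ _ => univ
            inj_nonempty := fun p q hq => by
              obtain ⟨φ⟩ := A.equivalent p q hq
              exact ⟨φ, mem_univ φ⟩
            mem_inj_iff := fun q p φ _ ψ => ⟨fun _ => hrigid φ ψ, fun _ => mem_univ ψ⟩
            inj_comp := fun q p χ _ => Eventually.of_forall fun y r φ _ _ η _ _ => mem_univ η },
    rfl, ?_⟩
  rintro O rfl
  obtain ⟨B, inj, h1, h2, h3⟩ := O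
  have : inj = fun _ _ => univ := by
    funext q p
    refine eq_univ_of_forall fun ψ => ?_
    obtain ⟨φ, hφ⟩ := h1 p q ψ.mem_image
    exact (h2 q p φ hφ ψ).2 (hrigid φ ψ)
  subst this
  rfl

theorem ConjTuple.mk_eq_mk_iff {G : Type v} [Group G] {k : ℕ} {g h : Fin k → G} :
    ConjTuple.mk g = ConjTuple.mk h ↔ ∃ a : G, ∀ i, h i = a * g i * a⁻¹ :=
  Quotient.eq (r := conjTupleSetoid G k)

theorem ConjTuple.exists_rep {G : Type v} [Group G] {k : ℕ} (c : ConjTuple G k) :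
    ∃ g, ConjTuple.mk g = c := Quotient.exists_rep c

/-! ### Composition of patching injections and the sector maps -/

namespace Orbifold

variable {X : Type u} [TopologicalSpace X] {O : Orbifold.{u, v} X} {p q r : X}

theorem smul_mem {φ : OrbInjection (O.chart q) (O.chart p)} (hφ : φ ∈ O.inj q p)
    (g : (O.chart p).Grp) : OrbInjection.smul g φ ∈ O.inj q p :=
  (O.mem_inj_iff q p φ hφ _).2 ⟨g, Eventually.of_forall fun _ => rfl, fun _ => rfl⟩

/-- Patching injections compose, near the origin. -/
theorem comp_mem {χ : OrbInjection (O.chart q) (O.chart p)} (hχ : χ ∈ O.inj q p) :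
    ∀ᶠ y in 𝓝 (0 : OrbModel (O.chart q).dim), ∀ r, ∀ φ ∈ O.inj r q, φ.toFun 0 = y →
      ∃ η ∈ O.inj r p, η.toFun = χ.toFun ∘ φ.toFun ∧ η.hom = χ.hom.comp φ.hom := by
  filter_upwards [O.inj_comp q p χ hχ, χ.dom_mem_nhds] with y h1 h2 r φ hφ h0
  obtain ⟨η, hη, hη'⟩ := χ.exists_comp φ (by rwa [h0])
  exact ⟨η, h1 r φ hφ h0 η (Eventually.of_forall fun x => by rw [hη]; rfl)
    fun a => by rw [hη']; rfl, hη, hη'⟩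

/-- The identity is not assumed to be a patching injection. A patching injection `φ` at `p` fixes
the origin, and `φ ∘ φ` lies in the class of `φ`, so `φ ∘ φ = g ∘ φ` near the origin. Cancelling `φ`
shows that `φ` is the automorphism given by `g`, and composing with `g⁻¹` yields the identity. -/
theorem refl_mem (p : X) : OrbInjection.refl (O.chart p) ∈ O.inj p p := by
  obtain ⟨φ, hφ⟩ := O.inj_nonempty p p (O.chart p).mem_image_self
  have h0 : φ.toFun 0 = 0 :=
    ((O.chart p).proj_eq_iff _ φ.map_zero_mem).1 φ.proj_map_zero
  obtain ⟨η, hη, hηf, hηh⟩ := (comp_mem hφ).self_of_nhds p φ hφ h0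
  obtain ⟨g, hg, hg'⟩ := (O.mem_inj_iff p p φ hφ η).1 hη
  have h1 : ∀ᶠ y in 𝓝 (0 : OrbModel (O.chart p).dim), φ.toFun y = (O.chart p).act g y := by
    have : ∀ᶠ y in 𝓝 (φ.toFun 0), φ.toFun y = (O.chart p).act g y := by
      rw [← φ.map_nhds_eq φ.zero_mem_dom, eventually_map]
      filter_upwards [hg] with x hx
      rw [← hx, hηf]
      rfl
    rwa [h0] at this
  have h2 : ∀ a, φ.hom a = g * a * g⁻¹ := by
    intro a
    obtain ⟨b, rfl⟩ := (Finite.injective_iff_surjective.1 φ.hom_injective) a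
    rw [← hg' b, hηh]
    rfl
  refine (O.mem_inj_iff p p φ hφ _).2 ⟨g⁻¹, ?_, fun a => ?_⟩
  · filter_upwards [h1, (O.chart p).isOpen_V.eventually_mem (O.chart p).zero_mem_V] with x hx hxV
    rw [hx, OrbChart.act_inv_act g hxV]
    rfl
  · rw [h2 a]
    change a = _
    group

/-- A patching injection sends the origin to some point of the fibre of `y`, and the fibre is a
single group orbit. -/
theorem exists_inj_map_zero_eq {y : OrbModel (O.chart p).dim} (hy : y ∈ (O.chart p).V) :
    ∃ φ ∈ O.inj ((O.chart p).proj y) p, φ.toFun 0 = y := by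
  obtain ⟨φ, hφ⟩ := O.inj_nonempty p _ ⟨y, hy, rfl⟩
  obtain ⟨g, hg⟩ := ((O.chart p).proj_eq_proj_iff _ φ.map_zero_mem y hy).1 φ.proj_map_zero
  exact ⟨_, smul_mem hφ g, hg⟩

/-! ### Points of the multi-sector -/

variable {k : ℕ}

theorem zero_mem_fixedSet (g : Fin k → (O.chart p).Grp) : 0 ∈ (O.chart p).fixedSet g :=
  ⟨(O.chart p).zero_mem_V, fun i => OrbChart.act_zero (g i)⟩

theorem isSectorPoint_of_inj {φ : OrbInjection (O.chart q) (O.chart p)} (hφ : φ ∈ O.inj q p)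
    {h : Fin k → (O.chart q).Grp} {g : Fin k → (O.chart p).Grp} (hg : ∀ i, φ.hom (h i) = g i)
    {y : OrbModel (O.chart p).dim} (hy : φ.toFun 0 = y) :
    O.IsSectorPoint p g y ⟨q, ConjTuple.mk h⟩ :=
  ⟨h, rfl, φ, hφ, hy, hg⟩

/-- The injection representing a sector point can be chosen to match a given tuple. -/
theorem IsSectorPoint.exists_inj {g : Fin k → (O.chart p).Grp} {y : OrbModel (O.chart p).dim}
    {z : O.MultiSector k} (hz : O.IsSectorPoint p g y z) {h : Fin k → (O.chart z.pt).Grp}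
    (hh : ConjTuple.mk h = z.cls) :
    ∃ φ ∈ O.inj z.pt p, φ.toFun 0 = y ∧ ∀ i, φ.hom (h i) = g i := by
  obtain ⟨h', hz', φ, hφ, hy, hg⟩ := hz
  obtain ⟨a, ha⟩ := ConjTuple.mk_eq_mk_iff.1 (hz'.symm.trans hh.symm)
  -- Elements of the image of `τ` fix `y`, so composing with one changes only the lifted tuple, by
  -- conjugation.
  refine ⟨_, smul_mem hφ (φ.hom a)⁻¹, ?_, fun i => ?_⟩
  · rw [OrbInjection.smul_toFun, ← hy]
    exact OrbChart.act_inv_eq _ φ.map_zero_mem (φ.act_hom_map_zero a)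
  · rw [OrbInjection.smul_hom, ha, map_mul, map_mul, map_inv, ← hg i]
    group

theorem IsSectorPoint.mem_fixedSet {g : Fin k → (O.chart p).Grp} {y : OrbModel (O.chart p).dim}
    {z : O.MultiSector k} (hz : O.IsSectorPoint p g y z) : y ∈ (O.chart p).fixedSet g := by
  obtain ⟨h, -, φ, -, rfl, hg⟩ := hz
  exact ⟨φ.map_zero_mem, fun i => by rw [← hg, φ.act_hom_map_zero]⟩

/-- The entries of the tuple stabilize `y`, and the stabilizer is the image of `τ`, so the tuple
lifts. -/
theorem exists_isSectorPoint {g : Fin k → (O.chart p).Grp} {y : OrbModel (O.chart p).dim}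
    (hy : y ∈ (O.chart p).fixedSet g) : ∃ z, O.IsSectorPoint p g y z := by
  obtain ⟨φ, hφ, h0⟩ := exists_inj_map_zero_eq hy.1
  choose h hh using fun i => φ.exists_hom_eq (b := g i) (by rw [h0]; exact hy.2 i)
  exact ⟨_, isSectorPoint_of_inj hφ hh h0⟩

/-- Comparison of the points represented in one system. -/
theorem IsSectorPoint.eq_iff {g g' : Fin k → (O.chart p).Grp} {y y' : OrbModel (O.chart p).dim}
    {z z' : O.MultiSector k} (hz : O.IsSectorPoint p g y z) (hz' : O.IsSectorPoint p g' y' z') :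
    z = z' ↔ ∃ c : (O.chart p).Grp, (O.chart p).act c y = y' ∧ ∀ i, g' i = c * g i * c⁻¹ := by
  constructor
  · rintro rfl
    obtain ⟨h, hh, φ, hφ, rfl, hg⟩ := hz
    obtain ⟨φ', hφ', rfl, hg'⟩ := hz'.exists_inj hh.symm
    obtain ⟨c, hc, hc'⟩ := (O.mem_inj_iff _ _ φ hφ φ').1 hφ'
    exact ⟨c, hc.self_of_nhds.symm, fun i => by rw [← hg', hc', hg]⟩
  · rintro ⟨c, rfl, hc⟩
    have hy := hz.mem_fixedSet.1
    obtain ⟨q, cl⟩ := z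
    obtain ⟨q', cl'⟩ := z'
    obtain ⟨h, rfl, φ, hφ, rfl, hg⟩ : ∃ h : Fin k → (O.chart q).Grp, cl = ConjTuple.mk h ∧
      ∃ φ ∈ O.inj q p, φ.toFun 0 = y ∧ ∀ i, φ.hom (h i) = g i := hz
    obtain ⟨h', rfl, φ', hφ', h0, hg'⟩ : ∃ h : Fin k → (O.chart q').Grp, cl' = ConjTuple.mk h ∧
      ∃ φ' ∈ O.inj q' p, φ'.toFun 0 = (O.chart p).act c (φ.toFun 0) ∧
        ∀ i, φ'.hom (h i) = g' i := hz'
    have hqq : q = q' := by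
      rw [← φ.proj_map_zero, ← φ'.proj_map_zero, h0, OrbChart.proj_act c hy]
    subst hqq
    obtain ⟨b, hb, hb'⟩ := (O.mem_inj_iff _ _ φ hφ φ').1 hφ'
    -- Both `b` and `c` carry `φ(0)` to `φ'(0)`, so `b⁻¹ * c` stabilizes `φ(0)` and comes from some
    -- `a`. This `a` conjugates `h` to `h'`.
    obtain ⟨a, ha⟩ := φ.exists_hom_eq (b := b⁻¹ * c) (by
      rw [OrbChart.act_mul' _ _ hy, ← h0, hb.self_of_nhds, OrbChart.act_inv_act b hy])
    congr 1
    refine ConjTuple.mk_eq_mk_iff.2 ⟨a, fun i => φ.hom_injective ?_⟩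
    have h1 := hg' i
    rw [hb', hc, ← hg i] at h1
    rw [map_mul, map_mul, map_inv, ha]
    calc φ.hom (h' i) = b⁻¹ * (b * φ.hom (h' i) * b⁻¹) * b := by group
      _ = _ := by
        rw [h1]
        group

theorem isSectorPoint_sectorMap {g : Fin k → (O.chart p).Grp} {y : OrbModel (O.chart p).dim}
    (hy : y ∈ (O.chart p).fixedSet g) : O.IsSectorPoint p g y (O.sectorMap p g y) := by
  have h := exists_isSectorPoint hy
  rw [sectorMap, dif_pos h]
  exact h.choose_spec

theorem IsSectorPoint.sectorMap_eq {g : Fin k → (O.chart p).Grp} {y : OrbModel (O.chart p).dim}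
    {z : O.MultiSector k} (hz : O.IsSectorPoint p g y z) : O.sectorMap p g y = z :=
  ((isSectorPoint_sectorMap hz.mem_fixedSet).eq_iff hz).2
    ⟨1, (O.chart p).act_one y hz.mem_fixedSet.1, fun i => by group⟩

theorem sectorMap_eq_sectorMap_iff {g g' : Fin k → (O.chart p).Grp}
    {y y' : OrbModel (O.chart p).dim} (hy : y ∈ (O.chart p).fixedSet g)
    (hy' : y' ∈ (O.chart p).fixedSet g') : O.sectorMap p g y = O.sectorMap p g' y' ↔
      ∃ c : (O.chart p).Grp, (O.chart p).act c y = y' ∧ ∀ i, g' i = c * g i * c⁻¹ :=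
  (isSectorPoint_sectorMap hy).eq_iff (isSectorPoint_sectorMap hy')

theorem sectorMap_map_zero {φ : OrbInjection (O.chart q) (O.chart p)} (hφ : φ ∈ O.inj q p)
    {h : Fin k → (O.chart q).Grp} {g : Fin k → (O.chart p).Grp} (hg : ∀ i, φ.hom (h i) = g i) :
    O.sectorMap p g (φ.toFun 0) = ⟨q, ConjTuple.mk h⟩ :=
  (isSectorPoint_of_inj hφ hg rfl).sectorMap_eq

theorem sectorMap_zero (p : X) (g : Fin k → (O.chart p).Grp) :
    O.sectorMap p g 0 = ⟨p, ConjTuple.mk g⟩ :=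
  sectorMap_map_zero (refl_mem p) fun _ => rfl

theorem sectorMap_pt {g : Fin k → (O.chart p).Grp} {y : OrbModel (O.chart p).dim}
    (hy : y ∈ (O.chart p).fixedSet g) : (O.sectorMap p g y).pt = (O.chart p).proj y := by
  obtain ⟨h, -, φ, -, h0, -⟩ := isSectorPoint_sectorMap hy
  exact φ.proj_map_zero.symm.trans (congrArg _ h0)

theorem mem_tupleCentralizer_iff {g : Fin k → (O.chart p).Grp} {c : (O.chart p).Grp} :
    c ∈ O.tupleCentralizer g ↔ ∀ i, c * g i * c⁻¹ = g i := by
  simp only [tupleCentralizer, Subgroup.mem_iInf, Subgroup.mem_centralizer_singleton_iff,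
    mul_inv_eq_iff_eq_mul]

theorem act_mem_fixedSet {g g' : Fin k → (O.chart p).Grp} {c : (O.chart p).Grp}
    (hc : ∀ i, g' i = c * g i * c⁻¹) {y : OrbModel (O.chart p).dim}
    (hy : y ∈ (O.chart p).fixedSet g) :
    (O.chart p).act c y ∈ (O.chart p).fixedSet g' := by
  refine ⟨OrbChart.act_mem_V c hy.1, fun i => ?_⟩
  rw [hc, ← OrbChart.act_mul' _ _ hy.1, inv_mul_cancel_right, OrbChart.act_mul' _ _ hy.1, hy.2 i]

/-- An injection that matches the tuples restricts to the fixed-point sets. -/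
theorem inj_mem_fixedSet_iff (φ : OrbInjection (O.chart q) (O.chart p))
    {h : Fin k → (O.chart q).Grp} {g : Fin k → (O.chart p).Grp} (hg : ∀ i, φ.hom (h i) = g i)
    {x : OrbModel (O.chart q).dim} (hx : x ∈ φ.dom) :
    φ.toFun x ∈ (O.chart p).fixedSet g ↔ x ∈ (O.chart q).fixedSet h := by
  have h1 : ∀ i, (O.chart p).act (g i) (φ.toFun x) = φ.toFun x ↔ (O.chart q).act (h i) x = x := by
    intro i
    rw [← hg, ← φ.equivariant _ x hx]
    exact φ.injOn.eq_iff (φ.dom_invariant _ x hx) hx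
  simp only [OrbChart.fixedSet, Set.mem_ofPred_eq, h1, φ.mapsTo hx, φ.dom_subset hx, true_and]

/-- Patching injections that match the tuples are compatible with the maps `π_{p,𝐠}`. -/
theorem eventually_sectorMap_eq {φ : OrbInjection (O.chart q) (O.chart p)} (hφ : φ ∈ O.inj q p)
    {h : Fin k → (O.chart q).Grp} {g : Fin k → (O.chart p).Grp} (hg : ∀ i, φ.hom (h i) = g i) :
    ∀ᶠ x in 𝓝 (0 : OrbModel (O.chart q).dim), x ∈ (O.chart q).fixedSet h →
      φ.toFun x ∈ (O.chart p).fixedSet g ∧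
      O.sectorMap p g (φ.toFun x) = O.sectorMap q h x := by
  filter_upwards [comp_mem hφ, φ.dom_mem_nhds] with x hx hxd hfix
  refine ⟨(inj_mem_fixedSet_iff φ hg hxd).2 hfix, ?_⟩
  obtain ⟨l, hl, χ, hχ, h0, hχl⟩ := isSectorPoint_sectorMap hfix
  obtain ⟨η, hη, hηf, hηh⟩ := hx _ χ hχ h0
  refine IsSectorPoint.sectorMap_eq ⟨l, hl, η, hη, ?_, fun i => ?_⟩
  · rw [hηf, Function.comp_apply, h0]
  · rw [hηh, MonoidHom.comp_apply, hχl, hg]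

/-! ### Topology of the multi-sector -/

theorem isOpen_multiSector_iff {s : Set (O.MultiSector k)} :
    IsOpen s ↔ ∀ (p : X) (g : Fin k → (O.chart p).Grp),
      IsOpen ((fun y : (O.chart p).fixedSet g => O.sectorMap p g y) ⁻¹' s) := by
  simp only [isOpen_iSup_iff, isOpen_coinduced]

theorem continuous_sectorMap (p : X) (g : Fin k → (O.chart p).Grp) :
    Continuous fun y : (O.chart p).fixedSet g => O.sectorMap p g y :=
  continuous_def.2 fun _ hs => isOpen_multiSector_iff.1 hs p g

/-- If `x` and `y` represent the same point, patching injections `φ` and `φ'` from the system at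
that point reach them while matching one common tuple `l`. A fixed point near `x` is then `φ(v)`
with `v` fixed by `l`, and `φ'(v)` near `y` represents the same point. -/
theorem isOpenMap_sectorMap (p : X) (g : Fin k → (O.chart p).Grp) :
    IsOpenMap fun y : (O.chart p).fixedSet g => O.sectorMap p g y := by
  intro W hW
  obtain ⟨W, hWo, rfl⟩ := hW
  refine isOpen_multiSector_iff.2 fun q h => isOpen_iff_mem_nhds.2 ?_
  rintro ⟨x, hx⟩ ⟨⟨y, hy⟩, hyW, hxy⟩
  change y ∈ W at hyW
  change O.sectorMap p g y = O.sectorMap q h x at hxy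
  obtain ⟨l, hl, φ, hφ, h0, hφl⟩ := isSectorPoint_sectorMap hx
  obtain ⟨φ', hφ', h0', hφl'⟩ := (hxy ▸ isSectorPoint_sectorMap hy).exists_inj hl.symm
  have h1 : ∀ᶠ x' in 𝓝 x, x' ∈ (O.chart q).fixedSet h →
      ∃ y' ∈ (O.chart p).fixedSet g, y' ∈ W ∧ O.sectorMap p g y' = O.sectorMap q h x' := by
    rw [← h0, ← φ.map_nhds_eq φ.zero_mem_dom, eventually_map]
    filter_upwards [eventually_sectorMap_eq hφ hφl, eventually_sectorMap_eq hφ' hφl',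
      φ.dom_mem_nhds, φ'.continuousAt_zero (hWo.mem_nhds (h0' ▸ hyW))] with v hv hv' hvd hvW hvfix
    have hvl := (inj_mem_fixedSet_iff φ hφl hvd).1 hvfix
    exact ⟨_, (hv' hvl).1, hvW, (hv' hvl).2.trans (hv hvl).2.symm⟩
  rw [nhds_subtype_eq_comap]
  refine mem_of_superset (preimage_mem_comap h1) ?_
  rintro ⟨x', hx'⟩ hx''
  obtain ⟨y', hy', hyW', heq⟩ := hx'' hx'
  exact ⟨⟨y', hy'⟩, hyW', heq⟩

theorem sectorMapUniformizes (p : X) (g : Fin k → (O.chart p).Grp) :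
    O.SectorMapUniformizes p g := by
  refine ⟨fun y hy z => ⟨fun hz => hz.sectorMap_eq.symm, ?_⟩, sectorMap_zero p g,
    continuous_sectorMap p g, isOpenMap_sectorMap p g, fun c hc y hy => ?_, fun y hy y' hy' => ?_⟩
  · rintro rfl
    exact isSectorPoint_sectorMap hy
  · exact act_mem_fixedSet (fun i => (mem_tupleCentralizer_iff.1 hc i).symm) hy
  · rw [sectorMap_eq_sectorMap_iff hy hy']
    exact exists_congr fun c => by
      rw [mem_tupleCentralizer_iff, and_comm]
      exact and_congr_left fun _ => forall_congr' fun i => eq_comm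

/-- Every point of the multi-sector over the image of a system is represented in it. -/
theorem exists_sectorMap_eq {p : X} (z : O.MultiSector k) {y : OrbModel (O.chart p).dim}
    (hy : y ∈ (O.chart p).V) (hz : z.pt = (O.chart p).proj y) :
    ∃ g, y ∈ (O.chart p).fixedSet g ∧ O.sectorMap p g y = z := by
  obtain ⟨q, c⟩ := z
  dsimp only at hz
  subst hz
  obtain ⟨φ, hφ, h0⟩ := exists_inj_map_zero_eq hy
  obtain ⟨h, rfl⟩ := c.exists_rep
  have := isSectorPoint_of_inj hφ (h := h) (fun i => rfl) h0
  exact ⟨_, this.mem_fixedSet, this.sectorMap_eq⟩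

theorem continuous_pt : Continuous (MultiSector.pt : O.MultiSector k → X) := by
  refine continuous_def.2 fun s hs => isOpen_multiSector_iff.2 fun p g => ?_
  have h1 : Continuous fun y : (O.chart p).fixedSet g => (O.chart p).proj y :=
    continuousOn_iff_continuous_domRestrict.1
      ((O.chart p).proj_continuousOn.mono fun y hy => hy.1)
  convert hs.preimage h1 using 1
  ext y
  simp only [mem_preimage, sectorMap_pt y.2]

/-- Points over distinct points of `X` are separated in `X`. Over one `p`, the images of the
fixed-point sets of non-conjugate tuples are already disjoint, because a common value would produce
a conjugating element. -/
theorem t2Space_multiSector (O : Orbifold.{u, v} X) (k : ℕ) : T2Space (O.MultiSector k) := by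
  have := O.t2
  refine ⟨fun z z' hne => ?_⟩
  by_cases hpt : z.pt = z'.pt
  · obtain ⟨p, c⟩ := z
    obtain ⟨p', c'⟩ := z'
    dsimp only at hpt
    subst hpt
    obtain ⟨g, rfl⟩ := c.exists_rep
    obtain ⟨g', rfl⟩ := c'.exists_rep
    refine ⟨_, _, (isOpenMap_sectorMap p g).isOpen_range, (isOpenMap_sectorMap p g').isOpen_range,
      ⟨⟨0, zero_mem_fixedSet g⟩, sectorMap_zero p g⟩,
      ⟨⟨0, zero_mem_fixedSet g'⟩, sectorMap_zero p g'⟩, ?_⟩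
    rw [Set.disjoint_left]
    rintro _ ⟨⟨y, hy⟩, rfl⟩ ⟨⟨y', hy'⟩, heq⟩
    obtain ⟨c, -, hc⟩ := (sectorMap_eq_sectorMap_iff hy' hy).1 heq
    exact hne (by rw [ConjTuple.mk_eq_mk_iff.2 ⟨c, hc⟩])
  · obtain ⟨s, t, hs, ht, hzs, hzt, hst⟩ := t2_separation hpt
    exact ⟨_, _, hs.preimage continuous_pt, ht.preimage continuous_pt, hzs, hzt,
      hst.preimage _⟩

/-- Countably many uniformized sets cover `X`, each group has finitely many `k`-tuples, and each
sector map is an open quotient map from a second countable set onto its open image. -/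
theorem secondCountableTopology_multiSector (O : Orbifold.{u, v} X) (k : ℕ) :
    SecondCountableTopology (O.MultiSector k) := by
  have := O.secondCountable
  obtain ⟨T, hT, hcov⟩ := TopologicalSpace.countable_cover_nhds
    fun p : X => (O.chart p).isOpen_image.mem_nhds (O.chart p).mem_image_self
  have : Countable T := hT
  let U : (Σ p : T, Fin k → (O.chart p.1).Grp) → Set (O.MultiSector k) :=
    fun i => range fun y : (O.chart i.1.1).fixedSet i.2 => O.sectorMap i.1.1 i.2 y
  have hU : ∀ i, SecondCountableTopology (U i) := fun i => by
    have hq : IsOpenQuotientMap (rangeFactorization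
        fun y : (O.chart i.1.1).fixedSet i.2 => O.sectorMap i.1.1 i.2 y) :=
      ⟨rangeFactorization_surjective, (continuous_sectorMap _ _).subtype_mk _,
        (isOpenMap_sectorMap _ _).subtype_mk _⟩
    exact ((TopologicalSpace.isBasis_countableBasis _).isQuotientMap hq.isQuotientMap hq.isOpenMap)
      |>.secondCountableTopology ((TopologicalSpace.countable_countableBasis _).image _)
  refine TopologicalSpace.secondCountableTopology_of_countable_cover (U := U)
    (fun i => (isOpenMap_sectorMap _ _).isOpen_range) ?_
  refine eq_univ_of_forall fun z => ?_
  have : z.pt ∈ ⋃ p ∈ T, (O.chart p).image := hcov ▸ mem_univ _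
  obtain ⟨p, hp, y, hy, hyz⟩ := mem_iUnion₂.1 this
  obtain ⟨g, hg, hz⟩ := exists_sectorMap_eq z hy hyz.symm
  exact mem_iUnion.2 ⟨⟨⟨p, hp⟩, g⟩, ⟨y, hg⟩, hz⟩

/-- Finitely many images of half-radius balls cover `X`. Passing to closed half-balls makes the
relevant pieces of the fixed-point sets compact, and there are finitely many tuples. -/
theorem compactSpace_multiSector (O : Orbifold.{u, v} X) (k : ℕ) [CompactSpace X] :
    CompactSpace (O.MultiSector k) := by
  let B : ∀ p : X, Set (OrbModel (O.chart p).dim) := fun p => Metric.ball 0 ((O.chart p).radius / 2)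
  let K : ∀ p : X, Set (OrbModel (O.chart p).dim) :=
    fun p => Metric.closedBall 0 ((O.chart p).radius / 2)
  have hr : ∀ p : X, 0 < (O.chart p).radius := fun p => (O.chart p).radius_pos
  have hKV : ∀ p, K p ⊆ (O.chart p).V := fun p =>
    Metric.closedBall_subset_ball (by linarith [hr p])
  have hBK : ∀ p, B p ⊆ K p := fun p => Metric.ball_subset_closedBall
  obtain ⟨T, hT⟩ := isCompact_univ.elim_nhds_subcover (fun p : X => (O.chart p).proj '' B p)
    fun p _ => ((O.chart p).proj_open _ ((hBK p).trans (hKV p)) Metric.isOpen_ball).mem_nhds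
      ⟨0, Metric.mem_ball_self (by linarith [hr p]), (O.chart p).proj_zero⟩
  have hcpt : ∀ (p : X) (g : Fin k → (O.chart p).Grp),
      IsCompact (O.sectorMap p g '' (K p ∩ (O.chart p).fixedSet g)) := by
    intro p g
    have h1 : IsCompact (K p ∩ (O.chart p).fixedSet g) := by
      have hcl : IsClosed (K p ∩ (O.chart p).fixedSet g) := by
        -- The extra index `none` contributes `K p` itself, so the formula also holds for `k = 0`.
        have h2 : K p ∩ (O.chart p).fixedSet g =
            ⋂ i : Option (Fin k), i.elim (K p) fun i =>
              K p ∩ (fun x => ((O.chart p).act (g i) x, x)) ⁻¹' diagonal _ := by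
          ext x
          simp only [mem_iInter, Option.forall, Option.elim]
          exact ⟨fun h => ⟨h.1, fun i => ⟨h.1, h.2.2 i⟩⟩,
            fun h => ⟨h.1, hKV p h.1, fun i => (h.2 i).2⟩⟩
        rw [h2]
        refine isClosed_iInter fun i => ?_
        cases i with
        | none => exact Metric.isClosed_closedBall
        | some i =>
          exact (((OrbChart.continuousOn_act (g i)).mono (hKV p)).prodMk
            continuousOn_id).preimage_isClosed_of_isClosed Metric.isClosed_closedBall
              isClosed_diagonal
      exact (isCompact_closedBall _ _).of_isClosed_subset hcl inter_subset_left
    refine h1.image_of_continuousOn ?_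
    exact (continuousOn_iff_continuous_domRestrict.2 (continuous_sectorMap p g)).mono inter_subset_right
  refine ⟨?_⟩
  have huniv : (univ : Set (O.MultiSector k)) =
      ⋃ p ∈ T, ⋃ g, O.sectorMap p g '' (K p ∩ (O.chart p).fixedSet g) := by
    refine (eq_univ_of_forall fun z => ?_).symm
    obtain ⟨p, hp, y, hy, hyz⟩ := mem_iUnion₂.1 (hT.2 (mem_univ z.pt))
    obtain ⟨g, hg, hz⟩ := exists_sectorMap_eq z (hKV p (hBK p hy)) hyz.symm
    exact mem_iUnion₂.2 ⟨p, hp, mem_iUnion.2 ⟨g, y, ⟨hBK p hy, hg⟩, hz⟩⟩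
  rw [huniv]
  exact T.isCompact_biUnion fun p _ => isCompact_iUnion fun g => hcpt p g

end Orbifold

/-! ### Restriction of systems and injections to fixed-point sets -/

namespace Orbifold

variable {X : Type u} [TopologicalSpace X] {O : Orbifold.{u, v} X} {k : ℕ}

/-- A uniformizing system at `z = (p, (𝐠))` that is a restriction of `(V_p^𝐠, C(𝐠), π_{p,𝐠})`. -/
structure SectorChart (O : Orbifold.{u, v} X) {k : ℕ} (z : O.MultiSector k) where
  chart : OrbChart.{max u v, v} z
  rep : Fin k → (O.chart z.pt).Grp
  mk_rep : ConjTuple.mk rep = z.cls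
  hom : chart.Grp →* (O.chart z.pt).Grp
  hom_injective : Function.Injective hom
  hom_range : hom.range = O.tupleCentralizer rep
  emb : OrbModel chart.dim → OrbModel (O.chart z.pt).dim
  emb_zero : emb 0 = 0
  emb_smooth : ContDiffOn ℝ ∞ emb chart.V
  emb_injOn : InjOn emb chart.V
  emb_immersion : ∀ x ∈ chart.V, Function.Injective (fderiv ℝ emb x)
  emb_open : ∀ W ⊆ chart.V, IsOpen W →
    ∃ W', IsOpen W' ∧ emb '' W = W' ∩ (O.chart z.pt).fixedSet rep
  emb_equivariant : ∀ a, ∀ x ∈ chart.V, emb (chart.act a x) = (O.chart z.pt).act (hom a) (emb x)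
  proj_eq : ∀ x ∈ chart.V, chart.proj x = O.sectorMap z.pt rep (emb x)

namespace SectorChart

variable {z z' : O.MultiSector k} (C : O.SectorChart z) (C' : O.SectorChart z')

theorem emb_mem {x : OrbModel C.chart.dim} (hx : x ∈ C.chart.V) :
    C.emb x ∈ (O.chart z.pt).fixedSet C.rep := by
  obtain ⟨W', -, h⟩ := C.emb_open _ subset_rfl C.chart.isOpen_V
  exact (h ▸ mem_image_of_mem C.emb hx : C.emb x ∈ W' ∩ _).2

theorem emb_mem_V {x : OrbModel C.chart.dim} (hx : x ∈ C.chart.V) :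
    C.emb x ∈ (O.chart z.pt).V := (C.emb_mem hx).1

theorem contDiffAt_emb {x : OrbModel C.chart.dim} (hx : x ∈ C.chart.V) :
    ContDiffAt ℝ ∞ C.emb x := C.emb_smooth.contDiffAt (C.chart.isOpen_V.mem_nhds hx)

theorem differentiableAt_emb {x : OrbModel C.chart.dim} (hx : x ∈ C.chart.V) :
    DifferentiableAt ℝ C.emb x := (C.contDiffAt_emb hx).differentiableAt (by simp)

theorem continuousAt_emb {x : OrbModel C.chart.dim} (hx : x ∈ C.chart.V) :
    ContinuousAt C.emb x := (C.contDiffAt_emb hx).continuousAt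

theorem tendsto_emb_zero : Tendsto C.emb (𝓝 0) (𝓝 0) := by
  have := C.continuousAt_emb C.chart.zero_mem_V
  rwa [ContinuousAt, C.emb_zero] at this

theorem eventually_mem_V : ∀ᶠ x in 𝓝 (0 : OrbModel C.chart.dim), x ∈ C.chart.V :=
  C.chart.isOpen_V.eventually_mem C.chart.zero_mem_V

theorem hom_mem (a : C.chart.Grp) (i : Fin k) : C.hom a * C.rep i * (C.hom a)⁻¹ = C.rep i :=
  mem_tupleCentralizer_iff.1 (C.hom_range ▸ ⟨a, rfl⟩) i

theorem exists_hom_eq {c : (O.chart z.pt).Grp} (hc : ∀ i, c * C.rep i * c⁻¹ = C.rep i) :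
    ∃ a, C.hom a = c :=
  MonoidHom.mem_range.1 (C.hom_range ▸ mem_tupleCentralizer_iff.2 hc)

/-- The embedding has a smooth inverse near each of its values. -/
theorem exists_smooth_inverse {x : OrbModel C.chart.dim} (hx : x ∈ C.chart.V) :
    ∃ (U : Set (OrbModel (O.chart z.pt).dim))
      (ρ : OrbModel (O.chart z.pt).dim → OrbModel C.chart.dim),
      IsOpen U ∧ C.emb x ∈ U ∧ ContDiffOn ℝ ∞ ρ U ∧
      (∀ y ∈ U, y ∈ (O.chart z.pt).fixedSet C.rep → ρ y ∈ C.chart.V ∧ C.emb (ρ y) = y) ∧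
      ∀ x' ∈ C.chart.V, C.emb x' ∈ U → ρ (C.emb x') = x' := by
  -- A linear left inverse `P` of the derivative makes `P ∘ emb` a local diffeomorphism; `ρ` is its
  -- local inverse composed with `P`.
  obtain ⟨P, hP⟩ := LinearMap.exists_leftInverse_of_injective
    (fderiv ℝ C.emb x).toLinearMap (LinearMap.ker_eq_bot.2 (C.emb_immersion x hx))
  let P' : OrbModel (O.chart z.pt).dim →L[ℝ] OrbModel C.chart.dim := P.toContinuousLinearMap
  have hd : fderiv ℝ (P' ∘ C.emb) x = ContinuousLinearMap.id ℝ _ := by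
    rw [fderiv_comp x P'.differentiableAt (C.differentiableAt_emb hx), P'.fderiv]
    ext1 v
    exact DFunLike.congr_fun hP v
  obtain ⟨e, hxe, heV, hes, hsymm⟩ := exists_openPartialHomeomorph_of_bijective_fderiv
    C.chart.isOpen_V hx (P'.contDiff.comp_contDiffOn C.emb_smooth)
    (by rw [hd]; exact Function.bijective_id)
  -- Since `emb` is open onto the fixed-point set, every fixed point in `W'` is the value of `emb`
  -- at a point where the local inverse is valid.
  obtain ⟨W', hW', himg⟩ := C.emb_open e.source heV e.open_source
  have hfac : ∀ y ∈ W', y ∈ (O.chart z.pt).fixedSet C.rep →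
      e.symm (P' y) ∈ e.source ∧ C.emb (e.symm (P' y)) = y := by
    intro y hy hyf
    obtain ⟨s, hs, rfl⟩ : y ∈ C.emb '' e.source := himg ▸ ⟨hy, hyf⟩
    have : P' (C.emb s) = e s := (hes s).symm
    rw [this, e.left_inv hs]
    exact ⟨hs, rfl⟩
  refine ⟨W' ∩ P' ⁻¹' e.target, e.symm ∘ P', hW'.inter (e.open_target.preimage P'.continuous),
    ⟨?_, ?_⟩, hsymm.comp P'.contDiff.contDiffOn fun y hy => hy.2, ?_, ?_⟩
  · exact (himg ▸ mem_image_of_mem C.emb hxe : C.emb x ∈ W' ∩ _).1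
  · have : P' (C.emb x) = e x := (hes x).symm
    rw [mem_preimage, this]
    exact e.map_source hxe
  · exact fun y hy hyf => ⟨heV (hfac y hy.1 hyf).1, (hfac y hy.1 hyf).2⟩
  · intro x' hx' hU
    have h1 := hfac _ hU.1 (C.emb_mem hx')
    exact C.emb_injOn (heV h1.1) hx' h1.2

/-- The tangent space of `V_p^𝐠` consists of the vectors fixed by `𝐠`. -/
theorem mem_range_fderiv_emb_iff {x : OrbModel C.chart.dim} (hx : x ∈ C.chart.V)
    (v : OrbModel (O.chart z.pt).dim) :
    (∃ w, fderiv ℝ C.emb x w = v) ↔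
      ∀ i, fderiv ℝ ((O.chart z.pt).act (C.rep i)) (C.emb x) v = v := by
  have hy := C.emb_mem hx
  constructor
  · rintro ⟨w, rfl⟩ i
    have h1 : (O.chart z.pt).act (C.rep i) ∘ C.emb =ᶠ[𝓝 x] C.emb := by
      filter_upwards [C.chart.isOpen_V.mem_nhds hx] with x' hx' using (C.emb_mem hx').2 i
    have h2 := h1.fderiv_eq (𝕜 := ℝ)
    rw [fderiv_comp x (OrbChart.differentiableAt_act _ hy.1) (C.differentiableAt_emb hx)] at h2
    exact DFunLike.congr_fun h2 w
  · intro hv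
    -- In linearizing coordinates the line `t • v` is fixed by the tuple, so it gives a curve `γ` in
    -- the fixed-point set with velocity `v`. Near `t = 0` the curve equals `emb ∘ ρ ∘ γ`, and the
    -- chain rule puts `v` in the range.
    obtain ⟨e, hye, hey, heV, he, hsymm, hed, hact⟩ := OrbChart.exists_linearization hy.1
    obtain ⟨U, ρ, hU, hyU, hρ, hρU, -⟩ := C.exists_smooth_inverse hx
    have h0t : (0 : OrbModel (O.chart z.pt).dim) ∈ e.target := hey ▸ e.map_source hye
    have hsymm0 : e.symm 0 = C.emb x := by rw [← hey, e.left_inv hye]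
    let γ : ℝ → OrbModel (O.chart z.pt).dim := fun t => e.symm (t • v)
    have hγ0 : γ 0 = C.emb x := by simp [γ, hsymm0]
    have hsd : HasFDerivAt e.symm (ContinuousLinearMap.id ℝ (OrbModel (O.chart z.pt).dim)) 0 := by
      have hdsymm : DifferentiableAt ℝ e.symm 0 :=
        (hsymm.contDiffAt (e.open_target.mem_nhds h0t)).differentiableAt (by simp)
      have hde : DifferentiableAt ℝ e (e.symm 0) := by
        rw [hsymm0]
        exact (he.contDiffAt (e.open_source.mem_nhds hye)).differentiableAt (by simp)
      have h1 : e ∘ e.symm =ᶠ[𝓝 0] id := by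
        filter_upwards [e.open_target.mem_nhds h0t] with t ht using e.right_inv ht
      have h2 := h1.fderiv_eq (𝕜 := ℝ)
      rw [fderiv_comp 0 hde hdsymm, hsymm0, hed, fderiv_id, ContinuousLinearMap.id_comp] at h2
      rw [← h2]
      exact hdsymm.hasFDerivAt
    have hγd : HasDerivAt γ v 0 := by
      have h1 : HasDerivAt (fun t : ℝ => t • v) ((1 : ℝ) • v) 0 := (hasDerivAt_id 0).smul_const v
      have h2 : HasFDerivAt e.symm (ContinuousLinearMap.id ℝ (OrbModel (O.chart z.pt).dim))
          ((0 : ℝ) • v) := by rwa [zero_smul]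
      have h3 := h2.comp_hasDerivAt 0 h1
      rw [one_smul, ContinuousLinearMap.id_apply] at h3
      exact h3
    have hγt : ∀ᶠ t in 𝓝 (0 : ℝ), t • v ∈ e.target := by
      have : Tendsto (fun t : ℝ => t • v) (𝓝 0) (𝓝 0) :=
        (continuous_id.smul continuous_const).tendsto' _ _ (by simp)
      exact this (e.open_target.mem_nhds h0t)
    have hγU : ∀ᶠ t in 𝓝 (0 : ℝ), γ t ∈ U := by
      refine hγd.continuousAt.eventually ?_
      rw [hγ0]
      exact hU.mem_nhds hyU
    have hγfix : ∀ t : ℝ, t • v ∈ e.target → γ t ∈ (O.chart z.pt).fixedSet C.rep := by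
      intro t ht
      have hs := e.map_target ht
      refine ⟨heV hs, fun i => ?_⟩
      have h1 := hact _ (hy.2 i) _ hs
      refine e.injOn h1.1 hs ?_
      rw [h1.2, e.right_inv ht, map_smul, hv]
    have hVx : ρ (C.emb x) ∈ C.chart.V ∧ C.emb (ρ (C.emb x)) = C.emb x := hρU _ hyU hy
    have hρd : HasFDerivAt ρ (fderiv ℝ ρ (C.emb x)) (γ 0) := by
      rw [hγ0]
      exact ((hρ.contDiffAt (hU.mem_nhds hyU)).differentiableAt (by simp)).hasFDerivAt
    have hρx : ρ (γ 0) = x := by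
      rw [hγ0]
      exact C.emb_injOn hVx.1 hx hVx.2
    have hembd : HasFDerivAt C.emb (fderiv ℝ C.emb x) (ρ (γ 0)) := by
      rw [hρx]
      exact (C.differentiableAt_emb hx).hasFDerivAt
    have h1 := hembd.comp_hasDerivAt 0 (hρd.comp_hasDerivAt 0 hγd)
    have h2 : C.emb ∘ ρ ∘ γ =ᶠ[𝓝 0] γ := by
      filter_upwards [hγt, hγU] with t ht htU using (hρU _ htU (hγfix t ht)).2
    exact ⟨_, h1.unique (hγd.congr_of_eventuallyEq h2)⟩

/-- Groups of sector charts need not act effectively, even when those of `X` do. Together with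
`eventually_of_actsTrivially` this expresses the kernel by the action on the fixed-point set near
one point, a form that passes through patching injections. -/
theorem actsTrivially_of_eventually {a : C.chart.Grp} {x : OrbModel C.chart.dim}
    (hx : x ∈ C.chart.V)
    (h : ∀ᶠ y in 𝓝 (C.emb x), y ∈ (O.chart z.pt).fixedSet C.rep →
      (O.chart z.pt).act (C.hom a) y = y) : C.chart.ActsTrivially a := by
  refine OrbChart.actsTrivially_of_eventually a hx ?_
  filter_upwards [(C.continuousAt_emb hx).eventually h, C.chart.isOpen_V.mem_nhds hx] with x' h1 h2
  refine C.emb_injOn (OrbChart.act_mem_V a h2) h2 ?_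
  rw [C.emb_equivariant a x' h2, h1 (C.emb_mem h2)]

theorem eventually_of_actsTrivially {a : C.chart.Grp} (ha : C.chart.ActsTrivially a)
    {x : OrbModel C.chart.dim} (hx : x ∈ C.chart.V) :
    ∀ᶠ y in 𝓝 (C.emb x), y ∈ (O.chart z.pt).fixedSet C.rep →
      (O.chart z.pt).act (C.hom a) y = y := by
  obtain ⟨U, ρ, hU, hyU, -, hρU, -⟩ := C.exists_smooth_inverse hx
  filter_upwards [hU.mem_nhds hyU] with y h1 h2
  obtain ⟨h3, h4⟩ := hρU y h1 h2
  rw [← h4, ← C.emb_equivariant a _ h3, ha _ h3]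

/-- `φ` is the restriction of `Φ` to the fixed-point sets, which matches the tuples. -/
structure Restricts (φ : OrbInjection C'.chart C.chart)
    (Φ : OrbInjection (O.chart z'.pt) (O.chart z.pt)) : Prop where
  emb_eq : ∀ᶠ x in 𝓝 (0 : OrbModel C'.chart.dim), Φ.toFun (C'.emb x) = C.emb (φ.toFun x)
  hom_eq : ∀ a, Φ.hom (C'.hom a) = C.hom (φ.hom a)
  rep_eq : ∀ i, Φ.hom (C'.rep i) = C.rep i

/-- An injection that matches the tuples restricts to the fixed-point sets. -/
theorem exists_restricts {Φ : OrbInjection (O.chart z'.pt) (O.chart z.pt)}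
    (hΦ : Φ ∈ O.inj z'.pt z.pt) (hrep : ∀ i, Φ.hom (C'.rep i) = C.rep i)
    {x₀ : OrbModel C.chart.dim} (hx₀ : x₀ ∈ C.chart.V) (h0 : Φ.toFun 0 = C.emb x₀) :
    ∃ φ : OrbInjection C'.chart C.chart, φ.toFun 0 = x₀ ∧ C.Restricts C' φ Φ := by
  -- As `Φ.hom` matches the tuples, it maps one centralizer into the other.
  have hcent : ∀ a, ∃ b, C.hom b = Φ.hom (C'.hom a) := fun a => C.exists_hom_eq fun i => by
    rw [← hrep, ← map_inv, ← map_mul, ← map_mul, C'.hom_mem]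
  choose τ hτ using hcent
  let τ' : C'.chart.Grp →* C.chart.Grp := MonoidHom.mk' τ fun a b => C.hom_injective (by
    rw [hτ, map_mul, map_mul, map_mul, hτ, hτ])
  have hτ' : ∀ a, C.hom (τ' a) = Φ.hom (C'.hom a) := hτ
  obtain ⟨U, ρ, hU, hyU, hρ, hρU, hρx⟩ := C.exists_smooth_inverse hx₀
  have hgood : ∀ᶠ x in 𝓝 (0 : OrbModel C'.chart.dim),
      (x ∈ C'.chart.V ∧ C'.emb x ∈ Φ.dom) ∧ Φ.toFun (C'.emb x) ∈ U ∧
      O.sectorMap z.pt C.rep (Φ.toFun (C'.emb x)) = O.sectorMap z'.pt C'.rep (C'.emb x) := by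
    have h1 : ∀ᶠ y in 𝓝 (0 : OrbModel (O.chart z'.pt).dim), Φ.toFun y ∈ U :=
      Φ.continuousAt_zero.eventually (hU.mem_nhds (h0 ▸ hyU))
    have h2 : ∀ᶠ y in 𝓝 (0 : OrbModel (O.chart z'.pt).dim), y ∈ Φ.dom := Φ.dom_mem_nhds
    filter_upwards [C'.eventually_mem_V, C'.tendsto_emb_zero.eventually h1,
      C'.tendsto_emb_zero.eventually h2,
      C'.tendsto_emb_zero.eventually (eventually_sectorMap_eq hΦ hrep)] with x hx1 hx2 hx3 hx4
    exact ⟨⟨hx1, hx3⟩, hx2, (hx4 (C'.emb_mem hx1)).2⟩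
  let f : OrbModel C'.chart.dim → OrbModel C.chart.dim := fun x => ρ (Φ.toFun (C'.emb x))
  have hf : ∀ᶠ x in 𝓝 (0 : OrbModel C'.chart.dim),
      f x ∈ C.chart.V ∧ C.emb (f x) = Φ.toFun (C'.emb x) := by
    filter_upwards [hgood] with x hx
    exact hρU _ hx.2.1 ((inj_mem_fixedSet_iff Φ hrep hx.1.2).2 (C'.emb_mem hx.1.1))
  have hf0 : f 0 = x₀ := by
    simp only [f]
    rw [C'.emb_zero, h0]
    exact hρx x₀ hx₀ hyU
  have hsmooth : ∀ᶠ x in 𝓝 (0 : OrbModel C'.chart.dim), ContDiffAt ℝ ∞ f x := by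
    filter_upwards [hgood] with x hx
    exact (hρ.contDiffAt (hU.mem_nhds hx.2.1)).comp x
      ((Φ.contDiffAt hx.1.2).comp x (C'.contDiffAt_emb hx.1.1))
  have hfd : ∀ᶠ x in 𝓝 (0 : OrbModel C'.chart.dim), ∀ w, fderiv ℝ C.emb (f x) (fderiv ℝ f x w) =
      fderiv ℝ Φ.toFun (C'.emb x) (fderiv ℝ C'.emb x w) := by
    filter_upwards [hf.eventually_nhds, hgood, hsmooth] with x hx hxg hxs w
    have h1 : C.emb ∘ f =ᶠ[𝓝 x] Φ.toFun ∘ C'.emb := hx.mono fun x' h => h.2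
    have h2 := h1.fderiv_eq (𝕜 := ℝ)
    rw [fderiv_comp x (C.differentiableAt_emb hx.self_of_nhds.1) (hxs.differentiableAt (by simp)),
      fderiv_comp x (Φ.differentiableAt hxg.1.2) (C'.differentiableAt_emb hxg.1.1)] at h2
    exact DFunLike.congr_fun h2 w
  suffices hex : ∃ φ : OrbInjection C'.chart C.chart, φ.toFun = f ∧ φ.hom = τ' by
    obtain ⟨φ, hφf, hφh⟩ := hex
    refine ⟨φ, by rw [hφf, hf0], ?_, ?_, hrep⟩
    · filter_upwards [hf] with x hx
      rw [hφf, hx.2]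
    · intro a
      rw [hφh, hτ']
  refine OrbInjection.exists_of_germ f τ' hsmooth ?_ ?_ ?_ ?_ ?_ ?_ ?_
  · filter_upwards [hfd, hf, hgood] with x hx hxf hxg
    constructor
    · refine (injective_iff_map_eq_zero _).2 fun w hw => ?_
      have h1 := hx w
      rw [hw, map_zero] at h1
      have h2 := (Φ.fderiv_bijective _ hxg.1.2).1 (h1.symm.trans (map_zero _).symm)
      exact C'.emb_immersion x hxg.1.1 (h2.trans (map_zero _).symm)
    · intro w
      obtain ⟨u, hu⟩ := (Φ.fderiv_bijective _ hxg.1.2).2 (fderiv ℝ C.emb (f x) w)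
      -- The derivative of `Φ` intertwines the tangent actions of the two tuples, so the preimage
      -- `u` of a fixed vector is fixed, hence tangent to the source fixed-point set.
      obtain ⟨w', rfl⟩ := (C'.mem_range_fderiv_emb_iff hxg.1.1 u).2 fun i => by
        refine (Φ.fderiv_bijective _ hxg.1.2).1 ?_
        have h1 : Φ.toFun ∘ (O.chart z'.pt).act (C'.rep i) =ᶠ[𝓝 (C'.emb x)]
            (O.chart z.pt).act (C.rep i) ∘ Φ.toFun := by
          filter_upwards [Φ.dom_open.mem_nhds hxg.1.2] with y hy
          rw [Function.comp_apply, Φ.equivariant _ y hy, hrep]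
          rfl
        have h2 := h1.fderiv_eq (𝕜 := ℝ)
        have hfix := (C'.emb_mem hxg.1.1).2 i
        rw [fderiv_comp _ (by rw [hfix]; exact Φ.differentiableAt hxg.1.2)
          (OrbChart.differentiableAt_act _ (C'.emb_mem_V hxg.1.1)),
          fderiv_comp _ (OrbChart.differentiableAt_act _ (Φ.mapsTo hxg.1.2))
          (Φ.differentiableAt hxg.1.2), hfix] at h2
        have h3 := DFunLike.congr_fun h2 u
        simp only [ContinuousLinearMap.comp_apply] at h3
        rw [h3, hu, ← hxf.2]
        exact (C.mem_range_fderiv_emb_iff hxf.1 _).1 ⟨w, rfl⟩ i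
      refine ⟨w', C.emb_immersion _ hxf.1 ?_⟩
      rw [hx, hu]
  · refine ⟨_, hgood.and hf, fun x hx y hy h => ?_⟩
    refine C'.emb_injOn hx.1.1.1 hy.1.1.1 (Φ.injOn hx.1.1.2 hy.1.1.2 ?_)
    rw [← hx.2.2, ← hy.2.2, h]
  · filter_upwards [hf] with x hx using hx.1
  · have hact : ∀ᶠ x in 𝓝 (0 : OrbModel C'.chart.dim), ∀ a, f (C'.chart.act a x) ∈ C.chart.V ∧
        C.emb (f (C'.chart.act a x)) = Φ.toFun (C'.emb (C'.chart.act a x)) := by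
      refine eventually_all.2 fun a =>
        (OrbChart.continuousAt_act a C'.chart.zero_mem_V).eventually (p := fun x =>
          f x ∈ C.chart.V ∧ C.emb (f x) = Φ.toFun (C'.emb x)) ?_
      rwa [OrbChart.act_zero]
    filter_upwards [hact, hf, hgood] with x h1 h2 h3 a
    refine C.emb_injOn (h1 a).1 (OrbChart.act_mem_V _ h2.1) ?_
    rw [(h1 a).2, C.emb_equivariant _ _ h2.1, C'.emb_equivariant a x h3.1.1,
      Φ.equivariant _ _ h3.1.2, hτ', h2.2]
  · filter_upwards [hf, hgood] with x h1 h2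
    rw [C.proj_eq _ h1.1, h1.2, h2.2.2, C'.proj_eq x h2.1.1]
  · intro a b hab
    refine C'.hom_injective (Φ.hom_injective ?_)
    rw [← hτ', ← hτ', hab]
  · intro b
    constructor
    · intro hb
      -- An element `b` acting trivially fixes `emb x₀ = Φ(0)`, so it comes from some `c`.
      -- Injectivity of `Φ.hom` shows that `c` centralizes the source tuple.
      obtain ⟨c, hc⟩ := Φ.exists_hom_eq (b := C.hom b) (by
        rw [h0, ← C.emb_equivariant b x₀ hx₀, hb x₀ hx₀])
      obtain ⟨a, rfl⟩ := C'.exists_hom_eq (c := c) fun i => Φ.hom_injective (by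
        rw [map_mul, map_mul, map_inv, hc, hrep, C.hom_mem])
      refine ⟨a, ?_, C.hom_injective (by rw [hτ', hc])⟩
      refine C'.actsTrivially_of_eventually C'.chart.zero_mem_V ?_
      rw [C'.emb_zero]
      have h1 := C.eventually_of_actsTrivially hb hx₀
      rw [← h0] at h1
      filter_upwards [Φ.continuousAt_zero.eventually h1, Φ.dom_mem_nhds] with y h2 h3 h4
      refine Φ.injOn (Φ.dom_invariant _ y h3) h3 ?_
      rw [Φ.equivariant _ y h3, hc]
      exact h2 ((inj_mem_fixedSet_iff Φ hrep h3).2 h4)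
    · rintro ⟨a, ha, rfl⟩
      refine C.actsTrivially_of_eventually hx₀ ?_
      have h1 := C'.eventually_of_actsTrivially ha C'.chart.zero_mem_V
      rw [C'.emb_zero] at h1
      rw [← h0, ← Φ.map_nhds_eq Φ.zero_mem_dom, eventually_map]
      filter_upwards [h1, Φ.dom_mem_nhds] with y h2 h3 h4
      rw [hτ', ← Φ.equivariant _ y h3, h2 ((inj_mem_fixedSet_iff Φ hrep h3).1 h4)]

end SectorChart

end Orbifold

/-! ### Construction of the orbifold structure on the multi-sector -/

/-- Linear coordinates on a subspace in which the elements of a finite group of linear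
transformations are isometric as far as they preserve the subspace. -/
theorem exists_invariant_coordinates {n : ℕ} {G : Type*} [Group G] [Finite G]
    (D : G → OrbModel n →L[ℝ] OrbModel n) (hone : ∀ v, D 1 v = v)
    (hmul : ∀ a b v, D (a * b) v = D a (D b v)) (F : Submodule ℝ (OrbModel n)) :
    ∃ (m : ℕ) (L : OrbModel m →L[ℝ] OrbModel n) (P : OrbModel n →L[ℝ] OrbModel m),
      (∀ x, P (L x) = x) ∧ (∀ v, v ∈ F ↔ ∃ x, L x = v) ∧
      ∀ a x y, D a (L x) = L y → ‖y‖ = ‖x‖ := by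
  have : Fintype G := Fintype.ofFinite G
  -- The map `v ↦ (D g v)_g` pulls the Euclidean norm back to an invariant one. An orthonormal basis
  -- of `S(F)` gives the coordinates.
  let S : OrbModel n →ₗ[ℝ] PiLp 2 (fun _ : G => OrbModel n) :=
    (WithLp.linearEquiv 2 ℝ (G → OrbModel n)).symm.toLinearMap ∘ₗ
      LinearMap.pi fun g => (D g).toLinearMap
  have hS : ∀ v g, S v g = D g v := fun v g => rfl
  have hSinj : Function.Injective S := fun v w h => by
    have h1 : S v 1 = S w 1 := by rw [h]
    rwa [hS, hS, hone, hone] at h1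
  have hnorm : ∀ a v, ‖S (D a v)‖ = ‖S v‖ := by
    intro a v
    rw [PiLp.norm_eq_of_L2, PiLp.norm_eq_of_L2]
    congr 1
    refine Fintype.sum_equiv (Equiv.mulRight a) _ _ fun g => ?_
    rw [hS, hS, Equiv.coe_mulRight, hmul]
  let I : F ≃ₗ[ℝ] F.map S := Submodule.equivMapOfInjective S hSinj F
  let b := stdOrthonormalBasis ℝ (F.map S)
  let L : OrbModel (Module.finrank ℝ (F.map S)) →ₗ[ℝ] OrbModel n :=
    F.subtype ∘ₗ I.symm.toLinearMap ∘ₗ b.repr.symm.toLinearEquiv.toLinearMap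
  have hL : ∀ x, L x = (I.symm (b.repr.symm x) : OrbModel n) := fun x => rfl
  have hSL : ∀ x, ‖S (L x)‖ = ‖x‖ := by
    intro x
    have h1 : S (L x) = (I (I.symm (b.repr.symm x)) : PiLp 2 fun _ : G => OrbModel n) := rfl
    rw [h1, LinearEquiv.apply_symm_apply]
    exact b.repr.symm.norm_map x
  have hLinj : Function.Injective L := fun x y h => by
    rw [hL, hL] at h
    exact b.repr.symm.injective (I.symm.injective (Subtype.ext h))
  obtain ⟨P, hP⟩ := LinearMap.exists_leftInverse_of_injective L (LinearMap.ker_eq_bot.2 hLinj)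
  refine ⟨_, L.toContinuousLinearMap, P.toContinuousLinearMap,
    fun x => DFunLike.congr_fun hP x, fun v => ⟨fun hv => ?_, ?_⟩, fun a x y h => ?_⟩
  · refine ⟨b.repr (I ⟨v, hv⟩), ?_⟩
    change L _ = v
    rw [hL, LinearIsometryEquiv.symm_apply_apply, LinearEquiv.symm_apply_apply]
  · rintro ⟨x, rfl⟩
    exact (I.symm (b.repr.symm x)).2
  · rw [← hSL y, ← hSL x, ← hnorm a (L x)]
    exact congrArg (fun v => ‖S v‖) h.symm

namespace Orbifold

variable {X : Type u} [TopologicalSpace X] {O : Orbifold.{u, v} X} {k : ℕ}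

set_option maxHeartbeats 1000000 in
/-- The systems `(V_p^𝐠, C(𝐠), π_{p,𝐠})` restrict to uniformizing systems. -/
theorem nonempty_sectorChart (z : O.MultiSector k) : Nonempty (O.SectorChart z) := by
  obtain ⟨g, hg⟩ := z.cls.exists_rep
  have hz : O.sectorMap z.pt g 0 = z := by
    rw [sectorMap_zero, hg]
  obtain ⟨e, h0e, he0, heV, hes, hsymm, -, hact⟩ :=
    OrbChart.exists_linearization (O.chart z.pt).zero_mem_V
  let D : (O.chart z.pt).Grp → OrbModel (O.chart z.pt).dim →L[ℝ] OrbModel (O.chart z.pt).dim :=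
    fun a => fderiv ℝ ((O.chart z.pt).act a) 0
  have hD1 : ∀ v, D 1 v = v := fun v => by
    simp only [D, OrbChart.fderiv_act_one (O.chart z.pt).zero_mem_V, ContinuousLinearMap.id_apply]
  have hDmul : ∀ a b v, D (a * b) v = D a (D b v) := fun a b v => by
    simp only [D]
    rw [OrbChart.fderiv_act_mul a b (O.chart z.pt).zero_mem_V, OrbChart.act_zero]
    rfl
  have heq : ∀ a, ∀ x ∈ e.source, (O.chart z.pt).act a x ∈ e.source ∧ e ((O.chart z.pt).act a x) = D a (e x) :=
    fun a x hx => hact a (OrbChart.act_zero a) x hx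
  let F : Submodule ℝ (OrbModel (O.chart z.pt).dim) :=
    ⨅ i, LinearMap.ker ((D (g i)).toLinearMap - LinearMap.id)
  have hF : ∀ v, v ∈ F ↔ ∀ i, D (g i) v = v := fun v => by
    simp only [F, Submodule.mem_iInf, LinearMap.mem_ker, LinearMap.sub_apply, sub_eq_zero,
      LinearMap.id_apply, ContinuousLinearMap.coe_coe]
  obtain ⟨m, L, P, hPL, hFL, hnorm⟩ := exists_invariant_coordinates D hD1 hDmul F
  have hLfix : ∀ x i, D (g i) (L x) = L x := fun x => (hF _).1 ((hFL _).2 ⟨x, rfl⟩)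
  -- Elements commuting with the tuple preserve the fixed subspace `F`, on which `L ∘ P` is the
  -- identity.
  have hcL : ∀ c ∈ O.tupleCentralizer g, ∀ x, L (P (D c (L x))) = D c (L x) := by
    intro c hc x
    obtain ⟨y, hy⟩ := (hFL (D c (L x))).1 ((hF _).2 fun i => by
      have h1 := mem_tupleCentralizer_iff.1 hc i
      rw [← hDmul, ← h1, inv_mul_cancel_right, hDmul, hLfix])
    rw [← hy, hPL]
  obtain ⟨r, hr, hrt⟩ := Metric.isOpen_iff.1 (e.open_target.preimage L.continuous) 0 (by
    rw [mem_preimage, map_zero, ← he0]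
    exact e.map_source h0e)
  set B : Set (OrbModel m) := Metric.ball 0 r with hB
  have hrt' : ∀ x ∈ B, L x ∈ e.target := hrt
  let act : O.tupleCentralizer g → OrbModel m → OrbModel m := fun c x => P (D c.1 (L x))
  have hLact : ∀ (c : O.tupleCentralizer g) x, L (act c x) = D c.1 (L x) := fun c x => hcL c.1 c.2 x
  have hLinj : Function.Injective L := Function.LeftInverse.injective hPL
  -- Invariance of the norm is what makes the round ball stable under `C(𝐠)`.
  have hactB : ∀ c, ∀ x ∈ B, act c x ∈ B := fun c x hx => by
    rw [hB, mem_ball_zero_iff] at hx ⊢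
    rwa [hnorm c.1 x (act c x) (hLact c x).symm]
  let emb : OrbModel m → OrbModel (O.chart z.pt).dim := fun x => e.symm (L x)
  have hembs : ∀ x ∈ B, emb x ∈ e.source := fun x hx => e.map_target (hrt' x hx)
  have heemb : ∀ x ∈ B, e (emb x) = L x := fun x hx => e.right_inv (hrt' x hx)
  have hembfix : ∀ x ∈ B, emb x ∈ (O.chart z.pt).fixedSet g := fun x hx =>
    ⟨heV (hembs x hx), fun i => e.injOn (heq _ _ (hembs x hx)).1 (hembs x hx) (by
      rw [(heq _ _ (hembs x hx)).2, heemb x hx, hLfix])⟩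
  have hemb0 : emb 0 = 0 := by
    have h1 := e.left_inv h0e
    rw [he0] at h1
    simp only [emb, map_zero, h1]
  have hinj : InjOn emb B := fun x hx y hy h => by
    refine hLinj ?_
    rw [← heemb x hx, ← heemb y hy, h]
  have hembact : ∀ c, ∀ x ∈ B, emb (act c x) = (O.chart z.pt).act c.1 (emb x) := by
    intro c x hx
    have h1 := heq c.1 _ (hembs x hx)
    refine e.injOn (hembs _ (hactB c x hx)) h1.1 ?_
    rw [h1.2, heemb _ (hactB c x hx), heemb x hx, hLact]
  have hsm : ContDiffOn ℝ ∞ emb B := hsymm.comp L.contDiff.contDiffOn hrt'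
  have hopen : ∀ W ⊆ B, IsOpen W → ∃ W', IsOpen W' ∧ emb '' W = W' ∩ (O.chart z.pt).fixedSet g := by
    intro W hWB hW
    -- A fixed point `y` of the source has `e y` in the range of `L`, where `P` inverts `L`; so on
    -- fixed points this open set cuts out exactly `emb '' W`.
    refine ⟨e.source ∩ e ⁻¹' (P ⁻¹' W), e.isOpen_inter_preimage (hW.preimage P.continuous), ?_⟩
    ext y
    constructor
    · rintro ⟨x, hx, rfl⟩
      refine ⟨⟨hembs x (hWB hx), ?_⟩, hembfix x (hWB hx)⟩
      rw [mem_preimage, mem_preimage, heemb x (hWB hx), hPL]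
      exact hx
    · rintro ⟨⟨hys, hyW⟩, hyf⟩
      obtain ⟨x, hx⟩ := (hFL (e y)).1 ((hF _).2 fun i => by rw [← (heq _ y hys).2, hyf.2 i])
      rw [mem_preimage, mem_preimage, ← hx, hPL] at hyW
      refine ⟨x, hyW, ?_⟩
      simp only [emb]
      rw [hx, e.left_inv hys]
  have hproj : ∀ x ∈ B, ∀ y ∈ B, O.sectorMap z.pt g (emb x) = O.sectorMap z.pt g (emb y) ↔
      ∃ c, act c x = y := by
    intro x hx y hy
    rw [(sectorMapUniformizes z.pt g).2.2.2.2.2 _ (hembfix x hx) _ (hembfix y hy), Subtype.exists]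
    refine exists_congr fun c => ?_
    rw [← exists_prop]
    refine exists_congr fun hc => ?_
    have h1 : (O.chart z.pt).act c (emb x) = emb (act ⟨c, hc⟩ x) := (hembact ⟨c, hc⟩ x hx).symm
    rw [h1]
    exact hinj.eq_iff (hactB _ x hx) hy
  have h0B : (0 : OrbModel m) ∈ B := Metric.mem_ball_self hr
  exact ⟨{
    chart :=
      { dim := m
        radius := r
        radius_pos := hr
        Grp := O.tupleCentralizer g
        act := act
        act_mem := hactB
        act_one := fun x _ => hLinj (by rw [hLact]; exact hD1 _)
        act_mul := fun a b x _ => hLinj (by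
          rw [hLact, hLact, hLact]
          exact hDmul _ _ _)
        act_smooth := fun a =>
          (P.contDiff.comp ((D a.1).contDiff.comp L.contDiff)).contDiffOn
        proj := fun x => O.sectorMap z.pt g (emb x)
        proj_continuousOn := ContinuousOn.comp (g := O.sectorMap z.pt g)
          (continuousOn_iff_continuous_domRestrict.2 (continuous_sectorMap z.pt g))
          hsm.continuousOn hembfix
        proj_open := by
          intro W hWB hW
          obtain ⟨W', hW', himg⟩ := hopen W hWB hW
          convert isOpenMap_sectorMap z.pt g _ (hW'.preimage continuous_subtype_val) using 1
          ext z'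
          constructor
          · rintro ⟨x, hx, rfl⟩
            exact ⟨⟨emb x, hembfix x (hWB hx)⟩, (himg ▸ mem_image_of_mem emb hx :
              emb x ∈ W' ∩ _).1, rfl⟩
          · rintro ⟨⟨y, hy⟩, hyW, rfl⟩
            obtain ⟨x, hx, rfl⟩ : y ∈ emb '' W := himg ▸ ⟨hyW, hy⟩
            exact ⟨x, hx, rfl⟩
        proj_eq_proj_iff := hproj
        proj_eq_iff := by
          intro x hx
          have h1 := hproj 0 h0B x hx
          rw [hemb0, hz] at h1
          have h2 : ∀ c, act c 0 = 0 := fun c => by simp only [act, map_zero]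
          rw [eq_comm, h1]
          simp only [h2]
          exact ⟨fun ⟨_, h⟩ => h.symm, fun h => ⟨1, h.symm⟩⟩ }
    rep := g
    mk_rep := hg
    hom := (O.tupleCentralizer g).subtype
    hom_injective := Subtype.val_injective
    hom_range := Subgroup.range_subtype _
    emb := emb
    emb_zero := hemb0
    emb_smooth := hsm
    emb_injOn := hinj
    emb_immersion := by
      intro x hx
      have hxB : B ∈ 𝓝 x := Metric.isOpen_ball.mem_nhds hx
      have h1 : P ∘ e ∘ emb =ᶠ[𝓝 x] id := by
        filter_upwards [hxB] with y hy
        rw [Function.comp_apply, Function.comp_apply, heemb y hy, hPL]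
        rfl
      have h2 := h1.fderiv_eq (𝕜 := ℝ)
      have h3 : DifferentiableAt ℝ emb x := (hsm.contDiffAt hxB).differentiableAt (by simp)
      have h4 : DifferentiableAt ℝ (P ∘ e) (emb x) := P.differentiableAt.comp _
        ((hes.contDiffAt (e.open_source.mem_nhds (hembs x hx))).differentiableAt (by simp))
      rw [← Function.comp_assoc, fderiv_comp x h4 h3, fderiv_id] at h2
      exact Function.LeftInverse.injective (g := fderiv ℝ (P ∘ e) (emb x))
        fun v => DFunLike.congr_fun h2 v
    emb_open := hopen
    emb_equivariant := hembact
    proj_eq := fun x _ => rfl }⟩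

/-- The systems given by a family of sector charts form an orbifold structure. -/
noncomputable def sectorStructureOfCharts (O : Orbifold.{u, v} X) {k : ℕ}
    (C : ∀ z : O.MultiSector k, O.SectorChart z) : O.SectorStructure k := by
  have hne : ∀ z, ∀ z' ∈ (C z).chart.image, ∃ φ : OrbInjection (C z').chart (C z).chart,
      ∃ Φ ∈ O.inj z'.pt z.pt, (C z).Restricts (C z') φ Φ := by
    rintro z z' ⟨x, hx, hxz⟩
    rw [(C z).proj_eq x hx] at hxz
    obtain ⟨Φ, hΦ, h0, hrep⟩ :=
      (hxz ▸ isSectorPoint_sectorMap ((C z).emb_mem hx)).exists_inj (C z').mk_rep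
    obtain ⟨φ, -, hφ⟩ := (C z).exists_restricts (C z') hΦ hrep hx h0
    exact ⟨φ, Φ, hΦ, hφ⟩
  exact
  { t2 := t2Space_multiSector O k
    secondCountable := secondCountableTopology_multiSector O k
    chart := fun z => (C z).chart
    equivalent := fun z z' hz' => ⟨(hne z z' hz').choose⟩
    -- Membership is witnessed by a patching injection of `X`, so the axioms are checked on the
    -- witnesses and pulled back along the injective maps `emb` and `hom`.
    inj := fun z' z => {φ | ∃ Φ ∈ O.inj z'.pt z.pt, (C z).Restricts (C z') φ Φ}
    inj_nonempty := hne
    mem_inj_iff := by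
      rintro z' z φ ⟨Φ, hΦ, hφ⟩ ψ
      constructor
      · rintro ⟨Ψ, hΨ, hψ⟩
        obtain ⟨b, hb, hb'⟩ := (O.mem_inj_iff _ _ Φ hΦ Ψ).1 hΨ
        -- Both `Φ` and `Ψ` send the source tuple to the target tuple, so the element `b` relating
        -- them centralizes the target tuple.
        obtain ⟨a, rfl⟩ := (C z).exists_hom_eq (c := b) fun i => by
          have h1 := hψ.rep_eq i
          rwa [hb', hφ.rep_eq] at h1
        refine ⟨a, ?_, fun c => (C z).hom_injective ?_⟩
        · filter_upwards [(C z').tendsto_emb_zero.eventually hb, hφ.emb_eq, hψ.emb_eq,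
            φ.dom_mem_nhds, ψ.dom_mem_nhds] with x h1 h2 h3 h4 h5
          refine (C z).emb_injOn (ψ.mapsTo h5) (OrbChart.act_mem_V a (φ.mapsTo h4)) ?_
          rw [(C z).emb_equivariant a _ (φ.mapsTo h4), ← h3, h1, h2]
        · rw [← hψ.hom_eq, hb', hφ.hom_eq, map_mul, map_mul, map_inv]
      · rintro ⟨a, ha, ha'⟩
        refine ⟨_, smul_mem hΦ ((C z).hom a), ?_, fun c => ?_, fun i => ?_⟩
        · filter_upwards [ha, hφ.emb_eq, φ.dom_mem_nhds] with x h1 h2 h3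
          rw [OrbInjection.smul_toFun, h2, h1, (C z).emb_equivariant a _ (φ.mapsTo h3)]
        · rw [OrbInjection.smul_hom, ha', hφ.hom_eq, map_mul, map_mul, map_inv]
        · rw [OrbInjection.smul_hom, hφ.rep_eq, (C z).hom_mem]
    inj_comp := by
      rintro z' z χ ⟨Χ, hΧ, hχ⟩
      filter_upwards [(C z').tendsto_emb_zero.eventually (comp_mem hΧ), (C z').eventually_mem_V,
        hχ.emb_eq.eventually_nhds] with y h1 h2 h3
      rintro w φ ⟨Φ, hΦ, hφ⟩ rfl η hη hη'
      have hΦ0 : Φ.toFun 0 = (C z').emb (φ.toFun 0) := by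
        rw [← hφ.emb_eq.self_of_nhds, (C w).emb_zero]
      obtain ⟨H, hH, hHf, hHh⟩ := h1 _ Φ hΦ hΦ0
      refine ⟨H, hH, ?_, fun a => ?_, fun i => ?_⟩
      · filter_upwards [hη, hφ.emb_eq, φ.continuousAt_zero.eventually h3] with x h4 h5 h6
        rw [hHf, Function.comp_apply, h5, h6, h4]
      · rw [hHh, hη', MonoidHom.comp_apply, hφ.hom_eq, hχ.hom_eq]
      · rw [hHh, MonoidHom.comp_apply, hφ.rep_eq, hχ.rep_eq]
    rep := fun z => (C z).rep
    mk_rep := fun z => (C z).mk_rep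
    hom := fun z => (C z).hom
    hom_injective := fun z => (C z).hom_injective
    hom_range := fun z => (C z).hom_range
    emb := fun z => (C z).emb
    emb_zero := fun z => (C z).emb_zero
    emb_smooth := fun z => (C z).emb_smooth
    emb_injOn := fun z => (C z).emb_injOn
    emb_immersion := fun z => (C z).emb_immersion
    emb_open := fun z => (C z).emb_open
    emb_equivariant := fun z => (C z).emb_equivariant
    proj_eq := fun z => (C z).proj_eq
    mem_inj_iff_restrict := fun z' z φ =>
      exists_congr fun Φ => and_congr_right fun _ =>
        ⟨fun h => ⟨h.emb_eq, h.hom_eq, h.rep_eq⟩, fun h => ⟨h.1, h.2.1, h.2.2⟩⟩ }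

/-- The multi-sector is an orbifold. -/
theorem nonempty_sectorStructure (O : Orbifold.{u, v} X) (k : ℕ) :
    Nonempty (O.SectorStructure k) :=
  ⟨sectorStructureOfCharts O fun z => (nonempty_sectorChart z).some⟩

end Orbifold

/-! ### Codimension of fixed-point sets in the almost complex case -/

/-- A real vector space with a complex structure has even dimension. -/
theorem even_finrank_of_comp_self_eq_neg {W : Type*} [AddCommGroup W] [Module ℝ W]
    [FiniteDimensional ℝ W] (T : W →ₗ[ℝ] W) (hT : ∀ w, T (T w) = -w) :
    Even (Module.finrank ℝ W) := by
  by_contra hodd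
  rw [Nat.not_even_iff_odd] at hodd
  -- In odd dimension the determinant of `-1` is `-1`, which cannot equal the square of `det T`.
  have h1 : T ∘ₗ T = (-1 : ℝ) • LinearMap.id := LinearMap.ext fun w => by simp [hT]
  have h2 := congrArg LinearMap.det h1
  rw [LinearMap.det_comp, LinearMap.det_smul, LinearMap.det_id, mul_one, hodd.neg_one_pow] at h2
  nlinarith [mul_self_nonneg (LinearMap.det T)]

/-- On an almost complex orbifold, fixed-point sets have codimension at least two. -/
theorem OrbAlmostComplex.codimTwo {X : Type u} [TopologicalSpace X] {O : Orbifold.{u, v} X}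
    (J : OrbAlmostComplex O) : O.CodimTwo := by
  intro p g
  by_cases htriv : (O.chart p).ActsTrivially g
  · exact Or.inl htriv
  refine Or.inr fun x hx hfix => ?_
  set d := fderiv ℝ ((O.chart p).act g) x with hd
  set K := LinearMap.ker ((d - ContinuousLinearMap.id ℝ (OrbModel (O.chart p).dim)).toLinearMap)
    with hK
  have hmem : ∀ w, w ∈ K ↔ d w = w := fun w => by
    rw [hK, LinearMap.mem_ker, ContinuousLinearMap.coe_coe, sub_apply,
      ContinuousLinearMap.id_apply, sub_eq_zero]
  have hJ : ∀ w, J.J p x (J.J p x w) = -w := fun w => DFunLike.congr_fun (J.sq p x hx) w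
  have hcomm : ∀ w, d (J.J p x w) = J.J p x (d w) := fun w => by
    have := DFunLike.congr_fun (J.equivariant p g x hx) w
    rwa [hfix] at this
  -- At a fixed point `J` commutes with the derivative of `g`, so it preserves `K`.
  have heven : Even (Module.finrank ℝ K) :=
    even_finrank_of_comp_self_eq_neg
      ((J.J p x).toLinearMap.restrict (p := K) (q := K) fun w hw => (hmem _).2 (by
        rw [ContinuousLinearMap.coe_coe, hcomm, (hmem w).1 hw]))
      fun w => Subtype.ext (hJ w)
  have heven' : Even (O.chart p).dim := by
    have := even_finrank_of_comp_self_eq_neg (J.J p x).toLinearMap hJ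
    rwa [finrank_euclideanSpace_fin] at this
  -- If `K` were everything, `g` would be the identity to first order at `x` and act trivially. A
  -- proper subspace of even dimension in an even-dimensional space has codimension at least two.
  have hlt : Module.finrank ℝ K < (O.chart p).dim := by
    have hne : K ≠ ⊤ := fun htop => htriv (OrbChart.actsTrivially_of_fderiv_eq_id g hx hfix (by
      ext1 w
      exact (hmem w).1 (htop ▸ Submodule.mem_top)))
    have := Submodule.finrank_lt hne
    rwa [finrank_euclideanSpace_fin] at this
  obtain ⟨a, ha⟩ := heven
  obtain ⟨b, hb⟩ := heven'
  change Module.finrank ℝ K + 2 ≤ _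
  omega

namespace Orbifold

variable {X : Type u} [TopologicalSpace X] {O : Orbifold.{u, v} X} {k : ℕ}

/-! ### The evaluation maps -/

/-- The element `b` accounts for the representative of the class `(g_i)`, which need only be
conjugate to `g_i`. Composing a patching injection that represents `y` with `b` represents `b y` and
conjugates the `i`-th entry. -/
theorem sectorMap_act_eq_evalMap {p : X} {g : Fin k → (O.chart p).Grp} (i : Fin k)
    {y : OrbModel (O.chart p).dim} (hy : y ∈ (O.chart p).fixedSet g) (b : (O.chart p).Grp)
    {g' : Fin 1 → (O.chart p).Grp} (hg' : g' 0 = b * g i * b⁻¹) :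
    O.sectorMap p g' ((O.chart p).act b y) = O.evalMap i (O.sectorMap p g y) := by
  obtain ⟨h, hcls, φ, hφ, h0, hh⟩ := isSectorPoint_sectorMap hy
  refine IsSectorPoint.sectorMap_eq ⟨fun _ => h i, congrArg (ConjTuple.entry i) hcls, _,
    smul_mem hφ b, ?_, fun j => ?_⟩
  · exact congrArg ((O.chart p).act b) h0
  · rw [Fin.fin_one_eq_zero j, hg', ← hh i]
    rfl

theorem continuous_evalMap (i : Fin k) :
    Continuous (O.evalMap i : O.MultiSector k → O.MultiSector 1) := by
  refine continuous_def.2 fun s hs => isOpen_multiSector_iff.2 fun p g => ?_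
  have hsub : ∀ y ∈ (O.chart p).fixedSet g, y ∈ (O.chart p).fixedSet fun _ : Fin 1 => g i :=
    fun y hy => ⟨hy.1, fun _ => hy.2 i⟩
  have h1 := (continuous_sectorMap p fun _ : Fin 1 => g i).comp (continuous_inclusion hsub)
  convert hs.preimage h1 using 1
  ext ⟨y, hy⟩
  have h2 := sectorMap_act_eq_evalMap i hy 1 (g' := fun _ => g i) (by group)
  rw [(O.chart p).act_one y hy.1] at h2
  change O.evalMap i (O.sectorMap p g y) ∈ s ↔ O.sectorMap p (fun _ => g i) y ∈ s
  rw [h2]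

/-- The local lifting of the evaluation map: the inclusion `V_p^𝐠 ⊆ V_p^{g_i}`, followed by the
action of a group element that conjugates `g_i` to the representative chosen in its class. -/
theorem SectorChart.exists_evalMap_lift {z : O.MultiSector k} (C : O.SectorChart z) (i : Fin k)
    (C₁ : O.SectorChart (O.evalMap i z)) :
    ∃ (b : (O.chart z.pt).Grp) (D : Set (OrbModel C.chart.dim))
      (l : OrbModel C.chart.dim → OrbModel C₁.chart.dim),
      C₁.rep 0 = b * C.rep i * b⁻¹ ∧ IsOpen D ∧ IsPreconnected D ∧ 0 ∈ D ∧ D ⊆ C.chart.V ∧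
      (∀ a, ∀ x ∈ D, C.chart.act a x ∈ D) ∧ MapsTo l D C₁.chart.V ∧ ContDiffOn ℝ ∞ l D ∧
      ∀ x ∈ D, C₁.emb (l x) = (O.chart z.pt).act b (C.emb x) := by
  obtain ⟨b, hb⟩ : ∃ b : (O.chart z.pt).Grp, ∀ j : Fin 1, C₁.rep j = b * C.rep i * b⁻¹ := by
    have h1 : z.cls.entry i = ConjTuple.mk fun _ => C.rep i := by
      rw [← C.mk_rep]
      rfl
    exact ConjTuple.mk_eq_mk_iff.1 (h1.symm.trans C₁.mk_rep.symm)
  obtain ⟨U, ρ, hU, h0U, hρ, hρU, -⟩ := C₁.exists_smooth_inverse C₁.chart.zero_mem_V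
  rw [C₁.emb_zero] at h0U
  have hN : ∀ᶠ x in 𝓝 (0 : OrbModel C.chart.dim), (O.chart z.pt).act b (C.emb x) ∈ U := by
    refine C.tendsto_emb_zero.eventually ((OrbChart.continuousAt_act b
      (O.chart z.pt).zero_mem_V).eventually ?_)
    rw [OrbChart.act_zero]
    exact hU.mem_nhds h0U
  obtain ⟨D, hDo, hDc, hD0, hDV, hDsub, hDinv⟩ := OrbChart.exists_connected_invariant hN
  have hfix : ∀ x ∈ D, (O.chart z.pt).act b (C.emb x) ∈ (O.chart z.pt).fixedSet C₁.rep :=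
    fun x hx => act_mem_fixedSet (g := fun _ => C.rep i) hb
      ⟨C.emb_mem_V (hDV hx), fun _ => (C.emb_mem (hDV hx)).2 i⟩
  exact ⟨b, D, fun x => ρ ((O.chart z.pt).act b (C.emb x)), hb 0, hDo, hDc, hD0, hDV, hDinv,
    fun x hx => (hρU _ (hDsub hx) (hfix x hx)).1,
    hρ.comp (((O.chart z.pt).act_smooth b).comp (C.emb_smooth.mono hDV)
      fun x hx => C.emb_mem_V (hDV hx)) hDsub,
    fun x hx => (hρU _ (hDsub hx) (hfix x hx)).2⟩

/-! ### Almost complex structures -/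

/-- An almost complex structure restricts to the fixed-point sets. -/
theorem SectorChart.exists_almostComplex {z : O.MultiSector k} (C : O.SectorChart z)
    (J : OrbAlmostComplex O) :
    ∃ K : OrbModel C.chart.dim → (OrbModel C.chart.dim →L[ℝ] OrbModel C.chart.dim),
      ContDiffOn ℝ ∞ K C.chart.V ∧ ∀ x ∈ C.chart.V,
        (fderiv ℝ C.emb x).comp (K x) = (J.J z.pt (C.emb x)).comp (fderiv ℝ C.emb x) := by
  -- Tangent vectors are the vectors fixed by the tuple, and `J` commutes with the tangent action at
  -- fixed points.
  have htan : ∀ x ∈ C.chart.V, ∀ w, ∃ w', fderiv ℝ C.emb x w' =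
      J.J z.pt (C.emb x) (fderiv ℝ C.emb x w) := by
    intro x hx w
    refine (C.mem_range_fderiv_emb_iff hx _).2 fun i => ?_
    have h1 := DFunLike.congr_fun (J.equivariant z.pt (C.rep i) _ (C.emb_mem_V hx))
      (fderiv ℝ C.emb x w)
    rw [(C.emb_mem hx).2 i] at h1
    refine h1.trans ?_
    rw [ContinuousLinearMap.comp_apply, (C.mem_range_fderiv_emb_iff hx _).1 ⟨w, rfl⟩ i]
  have hloc : ∀ x ∈ C.chart.V,
      ∃ K : OrbModel C.chart.dim → (OrbModel C.chart.dim →L[ℝ] OrbModel C.chart.dim),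
      ContDiffAt ℝ ∞ K x ∧ ∀ᶠ x' in 𝓝 x,
        (fderiv ℝ C.emb x').comp (K x') = (J.J z.pt (C.emb x')).comp (fderiv ℝ C.emb x') := by
    intro x hx
    obtain ⟨U, ρ, hU, hxU, hρ, -, hρx⟩ := C.exists_smooth_inverse hx
    refine ⟨fun x' => (fderiv ℝ ρ (C.emb x')).comp
      ((J.J z.pt (C.emb x')).comp (fderiv ℝ C.emb x')), ?_, ?_⟩
    · have h1 : ContDiffAt ℝ ∞ (fderiv ℝ ρ) (C.emb x) :=
        (hρ.fderiv_of_isOpen (m := ∞) hU (by simp)).contDiffAt (hU.mem_nhds hxU)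
      have h2 : ContDiffAt ℝ ∞ (fderiv ℝ C.emb) x :=
        (C.emb_smooth.fderiv_of_isOpen (m := ∞) C.chart.isOpen_V (by simp)).contDiffAt
          (C.chart.isOpen_V.mem_nhds hx)
      have h3 : ContDiffAt ℝ ∞ (J.J z.pt) (C.emb x) :=
        (J.smooth z.pt).contDiffAt ((O.chart z.pt).isOpen_V.mem_nhds (C.emb_mem_V hx))
      exact (h1.comp x (C.contDiffAt_emb hx)).clm_comp
        ((h3.comp x (C.contDiffAt_emb hx)).clm_comp h2)
    · have hev : ∀ᶠ x' in 𝓝 x, x' ∈ C.chart.V ∧ C.emb x' ∈ U :=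
        (C.chart.isOpen_V.eventually_mem hx).and
          ((C.continuousAt_emb hx).eventually (hU.mem_nhds hxU))
      filter_upwards [hev.eventually_nhds] with x' hx'
      obtain ⟨hxV, hxU'⟩ := hx'.self_of_nhds
      have h1 : ρ ∘ C.emb =ᶠ[𝓝 x'] id := hx'.mono fun y hy => hρx y hy.1 hy.2
      have h2 := h1.fderiv_eq (𝕜 := ℝ)
      rw [fderiv_comp x' ((hρ.contDiffAt (hU.mem_nhds hxU')).differentiableAt (by simp))
        (C.differentiableAt_emb hxV), fderiv_id] at h2
      ext1 w
      obtain ⟨w', hw'⟩ := htan x' hxV w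
      have h3 : fderiv ℝ ρ (C.emb x') (fderiv ℝ C.emb x' w') = w' := DFunLike.congr_fun h2 w'
      simp only [ContinuousLinearMap.comp_apply]
      rw [← hw', h3]
  choose! K hK hK' using hloc
  -- The relation determines the endomorphism because the derivative of `emb` is injective. Hence
  -- the local smooth solutions agree where both are defined, and the diagonal choice is smooth.
  refine ⟨fun x => K x x, fun x hx => ?_, fun x hx => (hK' x hx).self_of_nhds⟩
  refine ((hK x hx).congr_of_eventuallyEq ?_).contDiffWithinAt
  filter_upwards [hK' x hx, C.chart.isOpen_V.mem_nhds hx] with x' h1 h2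
  ext1 w
  refine C.emb_immersion x' h2 ?_
  exact (DFunLike.congr_fun (hK' x' h2).self_of_nhds w).trans (DFunLike.congr_fun h1 w).symm

/-! ### Properties of an arbitrary sector structure -/

namespace SectorStructure

variable (S : O.SectorStructure k)

/-- The system of a sector structure at a point, with its embedding. -/
abbrev sectorChart (z : O.MultiSector k) : O.SectorChart z where
  chart := S.chart z
  rep := S.rep z
  mk_rep := S.mk_rep z
  hom := S.hom z
  hom_injective := S.hom_injective z
  hom_range := S.hom_range z
  emb := S.emb z
  emb_zero := S.emb_zero z
  emb_smooth := S.emb_smooth z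
  emb_injOn := S.emb_injOn z
  emb_immersion := S.emb_immersion z
  emb_open := S.emb_open z
  emb_equivariant := S.emb_equivariant z
  proj_eq := S.proj_eq z

theorem mem_inj_iff_restricts {z' z : O.MultiSector k}
    {φ : OrbInjection (S.chart z') (S.chart z)} :
    φ ∈ S.inj z' z ↔
      ∃ Φ ∈ O.inj z'.pt z.pt, (S.sectorChart z).Restricts (S.sectorChart z') φ Φ := by
  rw [S.mem_inj_iff_restrict]
  exact exists_congr fun Φ => and_congr_right fun _ =>
    ⟨fun h => ⟨h.1, h.2.1, h.2.2⟩, fun h => ⟨h.emb_eq, h.hom_eq, h.rep_eq⟩⟩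

/-- At every `y ∈ V_p^𝐠`, `(V_p^𝐠, C(𝐠), π_{p,𝐠})` defines the germ of the structure. -/
theorem exists_inj_eventually {p : X} {g : Fin k → (O.chart p).Grp}
    {y : OrbModel (O.chart p).dim} (hy : y ∈ (O.chart p).fixedSet g) :
    ∃ Φ ∈ O.inj (O.sectorMap p g y).pt p, Φ.toFun 0 = y ∧
      (∀ i, Φ.hom (S.rep (O.sectorMap p g y) i) = g i) ∧
      ∀ᶠ x in 𝓝 (0 : OrbModel (S.chart (O.sectorMap p g y)).dim),
        Φ.toFun (S.emb (O.sectorMap p g y) x) ∈ (O.chart p).fixedSet g ∧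
        (S.chart (O.sectorMap p g y)).proj x =
          O.sectorMap p g (Φ.toFun (S.emb (O.sectorMap p g y) x)) := by
  obtain ⟨Φ, hΦ, h0, hrep⟩ := (isSectorPoint_sectorMap hy).exists_inj (S.mk_rep _)
  refine ⟨Φ, hΦ, h0, hrep, ?_⟩
  filter_upwards [(S.sectorChart (O.sectorMap p g y)).tendsto_emb_zero.eventually
    (eventually_sectorMap_eq hΦ hrep), (S.sectorChart (O.sectorMap p g y)).eventually_mem_V]
    with x h1 h2
  have h3 := h1 ((S.sectorChart _).emb_mem h2)
  exact ⟨h3.1, (S.proj_eq _ x h2).trans h3.2.symm⟩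

/-- The projection to `X` as a smooth map. -/
def projMap : OrbSmoothMap S.toOrbifold O (fun z => z.pt) where
  continuous := continuous_pt
  dom z := (S.chart z).V
  dom_open z := (S.chart z).isOpen_V
  dom_connected z := (S.chart z).isPreconnected_V
  zero_mem_dom z := (S.chart z).zero_mem_V
  dom_subset _ := subset_rfl
  dom_invariant _ a _ hx := OrbChart.act_mem_V a hx
  lift := S.emb
  lift_mem z _ hx := (S.sectorChart z).emb_mem_V hx
  lift_smooth := S.emb_smooth
  lift_proj z x hx := by
    rw [S.proj_eq z x hx]
    exact (sectorMap_pt ((S.sectorChart z).emb_mem hx)).symm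
  lift_equivariant z a := ⟨S.hom z a, fun x hx => (S.emb_equivariant z a x hx).symm⟩
  lift_compatible p q φ hφ _ := by
    obtain ⟨Φ, hΦ, hφ⟩ := S.mem_inj_iff_restricts.1 hφ
    exact ⟨Φ, hΦ, hφ.emb_eq.mono fun _ h => h.symm⟩

/-- The evaluation maps are smooth, with the inclusions `V_p^𝐠 ⊆ V_p^{g_i}` as local liftings. -/
theorem exists_smooth_evalMap (T : O.SectorStructure 1) (i : Fin k) :
    ∃ F : OrbSmoothMap S.toOrbifold T.toOrbifold (O.evalMap i),
      ∀ z, ∃ b : (O.chart z.pt).Grp,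
        T.rep (O.evalMap i z) 0 = b * S.rep z i * b⁻¹ ∧
        ∀ x ∈ F.dom z,
          T.emb (O.evalMap i z) (F.lift z x) = (O.chart z.pt).act b (S.emb z x) := by
  choose b D l hb hDo hDc hD0 hDV hDinv hlV hl hemb using fun z =>
    (S.sectorChart z).exists_evalMap_lift i (T.sectorChart (O.evalMap i z))
  have hl0 : ∀ z, l z 0 = 0 := fun z => by
    refine (T.sectorChart (O.evalMap i z)).emb_injOn (hlV z (hD0 z))
      (T.chart (O.evalMap i z)).zero_mem_V ?_
    rw [hemb z 0 (hD0 z), (S.sectorChart z).emb_zero, (T.sectorChart _).emb_zero]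
    exact OrbChart.act_zero _
  refine ⟨
    { continuous := continuous_evalMap i
      dom := D
      dom_open := hDo
      dom_connected := hDc
      zero_mem_dom := hD0
      dom_subset := hDV
      dom_invariant := hDinv
      lift := l
      lift_mem := hlV
      lift_smooth := hl
      lift_proj := ?_
      lift_equivariant := ?_
      lift_compatible := ?_ }, fun z => ⟨b z, hb z, hemb z⟩⟩
  · intro z x hx
    have hxV := hDV z hx
    refine ((T.sectorChart _).proj_eq _ (hlV z hx)).trans ?_
    refine Eq.trans ?_ (congrArg (O.evalMap i) ((S.sectorChart z).proj_eq x hxV).symm)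
    rw [hemb z x hx]
    exact sectorMap_act_eq_evalMap i ((S.sectorChart z).emb_mem hxV) (b z) (hb z)
  · intro z a
    obtain ⟨c, hc⟩ := (T.sectorChart (O.evalMap i z)).exists_hom_eq
      (c := b z * (S.sectorChart z).hom a * (b z)⁻¹) fun j => by
        have h1 : (b z * (S.sectorChart z).hom a * (b z)⁻¹) *
            (b z * (S.sectorChart z).rep i * (b z)⁻¹) *
            (b z * (S.sectorChart z).hom a * (b z)⁻¹)⁻¹ =
            b z * (S.sectorChart z).rep i * (b z)⁻¹ := by
          conv_rhs => rw [← (S.sectorChart z).hom_mem a i]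
          group
        rw [Fin.fin_one_eq_zero j, hb z]
        exact h1
    refine ⟨c, fun x hx => ?_⟩
    refine (T.sectorChart (O.evalMap i z)).emb_injOn (OrbChart.act_mem_V c (hlV z hx))
      (hlV z (hDinv z a x hx)) ?_
    have hV := (S.sectorChart z).emb_mem_V (hDV z hx)
    refine ((T.sectorChart _).emb_equivariant c _ (hlV z hx)).trans ?_
    rw [hemb z _ (hDinv z a x hx), hemb z x hx, (S.sectorChart z).emb_equivariant a x (hDV z hx), hc]
    have h1 : (O.chart z.pt).act (b z * (S.sectorChart z).hom a * (b z)⁻¹)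
        ((O.chart z.pt).act (b z) ((S.sectorChart z).emb x)) =
        (O.chart z.pt).act (b z) ((O.chart z.pt).act ((S.sectorChart z).hom a)
          ((S.sectorChart z).emb x)) := by
      rw [← OrbChart.act_mul' _ _ hV, ← OrbChart.act_mul' _ _ hV, inv_mul_cancel_right]
    exact h1
  · intro p q φ hφ h0
    obtain ⟨Φ, hΦ, hφ⟩ := S.mem_inj_iff_restricts.1 hφ
    -- The liftings at `p` and `q` involve `b p` and `b q`. This correction of `Φ` satisfies `Ψ(b_q
    -- y) = b_p Φ(y)` on the domain of `Φ` and matches the chosen representatives of the `i`-th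
    -- entries.
    have hΨ := smul_mem hΦ (b p * (Φ.hom (b q))⁻¹)
    set Ψ := OrbInjection.smul (b p * (Φ.hom (b q))⁻¹) Φ with hΨdef
    have hΦ0 : Φ.toFun 0 = (S.sectorChart p).emb (φ.toFun 0) := by
      rw [← hφ.emb_eq.self_of_nhds, (S.sectorChart q).emb_zero]
    have hΨ0 : Ψ.toFun 0 = (T.sectorChart (O.evalMap i p)).emb (l p (φ.toFun 0)) := by
      rw [hemb p _ h0, ← hΦ0, hΨdef, OrbInjection.smul_toFun, OrbChart.act_mul' _ _ Φ.map_zero_mem,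
        OrbChart.act_inv_eq _ Φ.map_zero_mem (Φ.act_hom_map_zero _)]
    have hrep : ∀ j, Ψ.hom ((T.sectorChart (O.evalMap i q)).rep j) =
        (T.sectorChart (O.evalMap i p)).rep j := by
      intro j
      rw [Fin.fin_one_eq_zero j, hb p, hb q, ← hφ.rep_eq i, hΨdef, OrbInjection.smul_hom,
        map_mul, map_mul, map_inv]
      group
    obtain ⟨ψ, -, hψ⟩ := (T.sectorChart (O.evalMap i p)).exists_restricts
      (T.sectorChart (O.evalMap i q)) (z := O.evalMap i p) (z' := O.evalMap i q) hΨ hrep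
      (hlV p h0) hΨ0
    refine ⟨ψ, T.mem_inj_iff_restricts.2 ⟨Ψ, hΨ, hψ⟩, ?_⟩
    have hlt : Tendsto (l q) (𝓝 0) (𝓝 0) := by
      have := ((hl q).contDiffAt ((hDo q).mem_nhds (hD0 q))).continuousAt
      rwa [ContinuousAt, hl0] at this
    have hψd : ∀ᶠ x in 𝓝 (0 : OrbModel (T.chart (O.evalMap i q)).dim), x ∈ ψ.dom := ψ.dom_mem_nhds
    have hφd : ∀ᶠ x in 𝓝 (0 : OrbModel (S.chart q).dim), φ.toFun x ∈ D p :=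
      φ.continuousAt_zero.eventually ((hDo p).mem_nhds h0)
    have hΦd : ∀ᶠ x in 𝓝 (0 : OrbModel (O.chart q.pt).dim), x ∈ Φ.dom := Φ.dom_mem_nhds
    filter_upwards [hφd, hlt.eventually hψd, hlt.eventually hψ.emb_eq, hφ.emb_eq,
      (hDo q).mem_nhds (hD0 q), (S.sectorChart q).tendsto_emb_zero.eventually hΦd]
      with x h1 h2 h3 h4 h5 h6
    refine (T.sectorChart (O.evalMap i p)).emb_injOn (hlV p h1) (ψ.mapsTo h2) ?_
    have h7 : Ψ.toFun ((O.chart q.pt).act (b q) ((S.sectorChart q).emb x)) =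
        (O.chart p.pt).act (b p) ((S.sectorChart p).emb (φ.toFun x)) := by
      rw [hΨdef, OrbInjection.smul_toFun, Φ.equivariant _ _ h6,
        ← OrbChart.act_mul' _ _ (Φ.mapsTo h6), inv_mul_cancel_right, h4]
    exact ((hemb p _ h1).trans h7.symm).trans ((congrArg Ψ.toFun (hemb q x h5)).symm.trans h3)

/-- An almost complex structure restricts to the multi-sector. -/
theorem exists_almostComplex (J : OrbAlmostComplex O) :
    ∃ J' : OrbAlmostComplex S.toOrbifold, ∀ z, ∀ x ∈ (S.chart z).V,
      (fderiv ℝ (S.emb z) x).comp (J'.J z x) =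
        (J.J z.pt (S.emb z x)).comp (fderiv ℝ (S.emb z) x) := by
  choose K hK hK' using fun z => (S.sectorChart z).exists_almostComplex J
  have hKw : ∀ z, ∀ x ∈ (S.chart z).V, ∀ w, fderiv ℝ (S.emb z) x (K z x w) =
      J.J z.pt (S.emb z x) (fderiv ℝ (S.emb z) x w) := fun z x hx w =>
    DFunLike.congr_fun (hK' z x hx) w
  -- Each axiom is verified after applying the injective derivative of `emb`, where it becomes the
  -- corresponding axiom for `J`.
  refine ⟨
    { J := K
      smooth := hK
      sq := fun z x hx => ?_
      equivariant := fun z a x hx => ?_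
      compatible := fun z z' φ hφ => ?_ }, hK'⟩
  · ext1 w
    refine S.emb_immersion z x hx ?_
    rw [ContinuousLinearMap.comp_apply, hKw z x hx, hKw z x hx]
    have := DFunLike.congr_fun (J.sq z.pt _ ((S.sectorChart z).emb_mem_V hx))
      (fderiv ℝ (S.emb z) x w)
    refine this.trans ?_
    simp
  · ext1 w
    have hV := (S.sectorChart z).emb_mem_V hx
    have hax := OrbChart.act_mem_V a hx
    have hd : ∀ w, fderiv ℝ (S.emb z) ((S.chart z).act a x) (fderiv ℝ ((S.chart z).act a) x w) =
        fderiv ℝ ((O.chart z.pt).act (S.hom z a)) (S.emb z x) (fderiv ℝ (S.emb z) x w) := by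
      intro w
      have h1 : S.emb z ∘ (S.chart z).act a =ᶠ[𝓝 x] (O.chart z.pt).act (S.hom z a) ∘ S.emb z := by
        filter_upwards [(S.chart z).isOpen_V.mem_nhds hx] with y hy using S.emb_equivariant z a y hy
      have h2 := h1.fderiv_eq (𝕜 := ℝ)
      rw [fderiv_comp x ((S.sectorChart z).differentiableAt_emb hax)
        (OrbChart.differentiableAt_act a hx), fderiv_comp x (OrbChart.differentiableAt_act _ hV)
        ((S.sectorChart z).differentiableAt_emb hx)] at h2
      exact DFunLike.congr_fun h2 w
    refine S.emb_immersion z _ hax ?_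
    simp only [ContinuousLinearMap.comp_apply]
    rw [hd, hKw z x hx, hKw z _ hax, hd, S.emb_equivariant z a x hx]
    exact DFunLike.congr_fun (J.equivariant z.pt (S.hom z a) _ hV) _
  · obtain ⟨Φ, hΦ, hφ⟩ := S.mem_inj_iff_restricts.1 hφ
    have hΦd : ∀ᶠ x in 𝓝 (0 : OrbModel (O.chart z'.pt).dim), x ∈ Φ.dom := Φ.dom_mem_nhds
    filter_upwards [(S.sectorChart z').tendsto_emb_zero.eventually (J.compatible _ _ Φ hΦ),
      (S.sectorChart z').tendsto_emb_zero.eventually hΦd, hφ.emb_eq.eventually_nhds,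
      φ.dom_mem_nhds] with x h1 h2 h3 h4
    have hx := φ.dom_subset h4
    have hφx := φ.mapsTo h4
    have hd : ∀ w, fderiv ℝ Φ.toFun (S.emb z' x) (fderiv ℝ (S.emb z') x w) =
        fderiv ℝ (S.emb z) (φ.toFun x) (fderiv ℝ φ.toFun x w) := by
      intro w
      have h5 : Φ.toFun ∘ S.emb z' =ᶠ[𝓝 x] S.emb z ∘ φ.toFun := h3
      have h6 := h5.fderiv_eq (𝕜 := ℝ)
      rw [fderiv_comp x (Φ.differentiableAt h2) ((S.sectorChart z').differentiableAt_emb hx),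
        fderiv_comp x ((S.sectorChart z).differentiableAt_emb hφx) (φ.differentiableAt h4)] at h6
      exact DFunLike.congr_fun h6 w
    ext1 w
    refine S.emb_immersion z _ hφx ?_
    simp only [ContinuousLinearMap.comp_apply]
    rw [← hd, hKw z' x hx, hKw z _ hφx, ← hd]
    have h5 := DFunLike.congr_fun h1 (fderiv ℝ (S.emb z') x w)
    have h6 : Φ.toFun (S.emb z' x) = S.emb z (φ.toFun x) := h3.self_of_nhds
    rw [← h6]
    exact h5

end SectorStructure

/-! ### Connected components -/

/-- A uniformized set is the continuous image of a ball. Components are therefore open, and the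
orbifold structure restricts to them. -/
theorem image_subset_connectedComponent (p : X) : (O.chart p).image ⊆ connectedComponent p :=
  ((O.chart p).isPreconnected_V.image _ (O.chart p).proj_continuousOn).subset_connectedComponent
    (O.chart p).mem_image_self

theorem isOpen_connectedComponent (O : Orbifold.{u, v} X) (p : X) :
    IsOpen (connectedComponent p) := by
  refine isOpen_iff_mem_nhds.2 fun q hq => ?_
  rw [connectedComponent_eq hq]
  exact mem_of_superset ((O.chart q).isOpen_image.mem_nhds (O.chart q).mem_image_self)
    (image_subset_connectedComponent q)

/-- The derivative of an injection at the origin is bijective, so nearby systems have equal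
dimension. -/
theorem isLocallyConstant_dim (O : Orbifold.{u, v} X) :
    IsLocallyConstant fun p => (O.chart p).dim := by
  refine (IsLocallyConstant.iff_exists_open _).2 fun p =>
    ⟨_, (O.chart p).isOpen_image, (O.chart p).mem_image_self, fun q hq => ?_⟩
  obtain ⟨φ⟩ := O.equivalent p q hq
  exact φ.dim_eq

/-- A compact orbifold has finitely many components, each a closed connected orbifold. -/
theorem finite_and_isClosedConnected (O : Orbifold.{u, v} X) [CompactSpace X] :
    Finite (ConnectedComponents X) ∧ ∀ p : X, IsClopen (connectedComponent p) ∧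
      ∃ (hp : ∀ q ∈ connectedComponent p, (O.chart q).image ⊆ connectedComponent p) (n : ℕ),
        (O.restrict (connectedComponent p) hp).IsClosedConnected n := by
  constructor
  · have := ConnectedComponents.discreteTopology_iff.2 (isOpen_connectedComponent O)
    exact finite_of_compact_of_discrete
  · intro p
    refine ⟨⟨isClosed_connectedComponent, isOpen_connectedComponent O p⟩, fun q hq => ?_,
      (O.chart p).dim, isCompact_iff_compactSpace.1 isClosed_connectedComponent.isCompact,
      isConnected_iff_connectedSpace.1 isConnected_connectedComponent, fun q => ?_⟩
    · rw [connectedComponent_eq hq]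
      exact image_subset_connectedComponent q
    · exact (isLocallyConstant_dim O).apply_eq_of_isPreconnected isPreconnected_connectedComponent
        q.2 mem_connectedComponent

end Orbifold

/-- The `k`-multi-sector of an orbifold is naturally an orbifold. -/
theorem lemma4p1p1 {X : Type u} [TopologicalSpace X] :
    -- For a reduced orbifold the patching injections are determined by the uniformizing systems.
    (∀ A : OrbAtlas.{u, v} X, A.Reduced → ∃! O : Orbifold.{u, v} X, O.toOrbAtlas = A) ∧
    ∀ (O : Orbifold.{u, v} X) (k : ℕ),
      -- The multi-sector is an orbifold with the systems `(V_p^𝐠, C(𝐠), π_{p,𝐠})`.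
      (∀ (p : X) (g : Fin k → (O.chart p).Grp), O.SectorMapUniformizes p g) ∧
      Nonempty (O.SectorStructure k) ∧
      ∀ S : O.SectorStructure k,
        -- At every `y ∈ V_p^𝐠`, `(V_p^𝐠, C(𝐠), π_{p,𝐠})` defines the germ of this structure.
        (∀ (p : X) (g : Fin k → (O.chart p).Grp), ∀ y ∈ (O.chart p).fixedSet g,
          ∃ Φ ∈ O.inj (O.sectorMap p g y).pt p, Φ.toFun 0 = y ∧
            (∀ i, Φ.hom (S.rep (O.sectorMap p g y) i) = g i) ∧
            ∀ᶠ x in 𝓝 (0 : OrbModel (S.chart (O.sectorMap p g y)).dim),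
              Φ.toFun (S.emb (O.sectorMap p g y) x) ∈ (O.chart p).fixedSet g ∧
              (S.chart (O.sectorMap p g y)).proj x =
                O.sectorMap p g (Φ.toFun (S.emb (O.sectorMap p g y) x))) ∧
        -- The projection to `X` is smooth, with the inclusions `V_p^𝐠 ⊆ V_p` as liftings.
        (∃ F : OrbSmoothMap S.toOrbifold O (fun z => z.pt),
          ∀ z, ∀ x ∈ F.dom z, F.lift z x = S.emb z x) ∧
        -- The maps `e_i` are smooth, with the inclusions `V_p^𝐠 ⊆ V_p^{g_i}` as liftings.
        (∀ (T : O.SectorStructure 1) (i : Fin k),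
          ∃ F : OrbSmoothMap S.toOrbifold T.toOrbifold (O.evalMap i),
            ∀ z, ∃ b : (O.chart z.pt).Grp,
              T.rep (O.evalMap i z) 0 = b * S.rep z i * b⁻¹ ∧
              ∀ x ∈ F.dom z,
                T.emb (O.evalMap i z) (F.lift z x) = (O.chart z.pt).act b (S.emb z x)) ∧
        -- An almost complex structure on `X` restricts to one on the multi-sector.
        (∀ J : OrbAlmostComplex O,
          (∃ J' : OrbAlmostComplex S.toOrbifold, ∀ z, ∀ x ∈ (S.chart z).V,
            (fderiv ℝ (S.emb z) x).comp (J'.J z x) =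
              (J.J z.pt (S.emb z x)).comp (fderiv ℝ (S.emb z) x)) ∧
          S.CodimTwo) ∧
        -- If `X` is closed, the multi-sector is a finite disjoint union of closed orbifolds.
        (CompactSpace X →
          CompactSpace (O.MultiSector k) ∧ Finite (ConnectedComponents (O.MultiSector k)) ∧
          ∀ z : O.MultiSector k, IsClopen (connectedComponent z) ∧
            ∃ (hz : ∀ z' ∈ connectedComponent z, (S.chart z').image ⊆ connectedComponent z)
              (n : ℕ),
              (S.toOrbifold.restrict (connectedComponent z) hz).IsClosedConnected n) := by
  refine ⟨fun A hA => hA.existsUnique, fun O k => ⟨O.sectorMapUniformizes,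
    O.nonempty_sectorStructure k, fun S => ⟨fun p g y hy => S.exists_inj_eventually hy,
    ⟨S.projMap, fun z x _ => rfl⟩, S.exists_smooth_evalMap,
    fun J => ⟨S.exists_almostComplex J, ?_⟩, fun hX => ?_⟩⟩⟩
  · exact (S.exists_almostComplex J).choose.codimTwo
  · have := O.compactSpace_multiSector k
    obtain ⟨h1, h2⟩ := S.toOrbifold.finite_and_isClosedConnected
    exact ⟨this, h1, h2⟩
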